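/- Let $S$ and $S'$ be Coxeter generating sets of a group $W$, with $m_{st}\in\{2,3,\dots\}\cup\{\infty\}$ the exponents for $S$. For $J\subseteq S$ let $W_J=\langle J\rangle$ (similarly for $S'$); $J$ is \emph{spherical} if $W_J$ is finite. Let $J^\perp$ be the set of elements of $S\setminus J$ commuting with all of $J$; $J$ is \emph{irreducible} if it is not contained in $K\cup K^\perp$ for any non-empty proper subset $K\subset J$. Elements $s\neq t$ of $S$ are \emph{adjacent} if $\{s,t\}$ is spherical; this defines the \emph{defining graph} on $S$. For $J$ irreducible spherical, a \emph{component} of $S\setminus(J\cup J^\perp)$ is the vertex set of a connected component of the subgraph of the defining graph induced on $S\setminus(J\cup J^\perp)$, and $J$ \emph{weakly separates} $S$ if $S\setminus(J\cup J^\perp)$ is a disjoint union of two non-empty subsets $A,B$ with no element of $A$ adjacent to an element of $B$. Assume that $S$ is irreducible, non-spherical, and of type FC (every $T\subseteq S$ with $m_{tr}<\infty$ for all $t,r\in T$ is spherical). Assume that $S$ is angle-compatible with $S'$: for all (possibly equal) $s,t\in S$ with $\langle s,t\rangle$ finite, $\{s,t\}$ is conjugate to some $\{s',t'\}\subseteq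 S'$. The \emph{Davis complex} of $(W,S)$ is the complex with vertex set $W$ (whose elements are called chambers) whose cells are spanned on the left cosets $gW_J$ with $J$ spherical (similarly for $S'$). The \emph{wall} of a reflection $r$ (a conjugate of a generator) is its fixed-point set, and the \emph{half-spaces} for $r$ are the connected components of the complement of its wall. Let $\mathcal Y_r$ denote the wall of $r$ in the Davis complex of $(W,S)$, and $\mathcal W_r$ the wall of $r$ in the Davis complex of $(W,S')$. A chamber is \emph{incident} to a wall if it is an endpoint of an edge crossed by the wall, and the distance $d(c,\mathcal Y_r)$ is the minimal word-metric (gallery) distance from $c$ to a chamber incident to $\mathcal Y_r$. Let $c_0$ be the identity chamber. A \emph{base} with core $s\in S$ is a pair $(s,w)$, where $w=j_1\cdots j_n$ with $j_i$ pairwise distinct elements of $S\setminus\{s\}$, such that $d(w.c_0,\mathcal Y_s)=n$, every wall separating $w.c_0$ from $c_0$ intersects $\mathcal Y_s$, and the \emph{support} $J=\{s,j_1,\dots,j_n\}$ is spherical. A \emph{marking} $\mu=((s,w),m)$ with core $s$ and support $J$ consists of a base $(s,w)$ with support $J$ and a marker $m\in S$ such that $\{m,j\}$ is not spherical for some $j\in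 J$. Two markings with common core, supports $J,J'$ and markers $m,m'$, are related by move (M1) if $J=J'$ and $m,m'$ are adjacent, and by move (M2) if $m=m'$ and there is $j\in S$ adjacent to $m$ such that $J=J'\cup\{j\}$. We write $\mu\sim\nu$ if there is a finite sequence of moves M1 and M2 (in either direction) from $\mu$ to $\nu$. For a marking $\mu=((s,w),m)$ let $\Phi_s^\mu$ be the half-space for $s$ in the Davis complex of $(W,S')$ that contains $w\mathcal W_m$. \textbf{Proposition.} Let $I\subset S$ be irreducible spherical, and suppose that no irreducible spherical $I'\supsetneq I$ weakly separates $S$. Let $\mu_1,\mu_2$ be markings with common core $s\in I$, with supports $J_1,J_2\supseteq I$ and markers $m_1,m_2$. For $i=1,2$ let $K_i=J_i\setminus(I\cup I^\perp)$ if $I\subsetneq J_i$, and $K_i=\{m_i\}$ if $J_i=I$. Suppose that $K_1$ and $K_2$ are contained in the same component $C$ of $S\setminus(I\cup I^\perp)$. Then $\mu_1\sim\mu_2$. Moreover, $\Phi_s^{\mu_1}$ and $\Phi_s^{\mu_2}$ are well defined (for each $i$ there is exactly one half-space for $s$ containing $w_i\mathcal W_{m_i}$, where $w_i$ is the group element of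 the base of $\mu_i$), and $\Phi_s^{\mu_1}=\Phi_s^{\mu_2}$. -/

import Mathlib

open scoped Pointwise

namespace CoxDavis

section Combinatorics

variable {B W : Type*} [Group W] {M : CoxeterMatrix B}

/-- The subgroup `W_J` generated by the subset `J` of the Coxeter generating set. The Coxeter
generating set `S` is the image of `cs.simple`, and subsets of `S` are sets of indices. -/
def parabolic (cs : CoxeterSystem M W) (J : Set B) : Subgroup W :=
  Subgroup.closure (cs.simple '' J)

/-- `J` is spherical if `W_J` is finite. -/
def IsSpherical (cs : CoxeterSystem M W) (J : Set B) : Prop :=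
  (parabolic cs J : Set W).Finite

/-- `J^⊥`: the elements of `S \ J` that commute with every element of `J`. -/
def perp (cs : CoxeterSystem M W) (J : Set B) : Set B :=
  {t | t ∉ J ∧ ∀ j ∈ J, Commute (cs.simple t) (cs.simple j)}

/-- `J` is irreducible if it is not contained in `K ∪ K^⊥` for any non-empty proper subset
`K` of `J`. -/
def IsIrreducible (cs : CoxeterSystem M W) (J : Set B) : Prop :=
  ¬ ∃ K : Set B, K.Nonempty ∧ K ⊂ J ∧ J ⊆ K ∪ perp cs K

/-- Type FC: a subset `T` with all `m_{tr}` finite is spherical (in a `CoxeterMatrix`, the entry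
`0` stands for `∞`). -/
def IsTypeFC (cs : CoxeterSystem M W) : Prop :=
  ∀ T : Set B, (∀ t ∈ T, ∀ r ∈ T, M t r ≠ 0) → IsSpherical cs T

/-- The defining graph: `s ≠ t` are adjacent if `{s, t}` is spherical. -/
def definingGraph (cs : CoxeterSystem M W) : SimpleGraph B where
  Adj s t := s ≠ t ∧ IsSpherical cs {s, t}
  symm := ⟨fun s t h => ⟨h.1.symm, by rw [Set.pair_comm]; exact h.2⟩⟩
  loopless := ⟨fun _ h => h.1 rfl⟩

/-- `C` is (the vertex set of) a connected component of the subgraph of the defining graph induced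
on `S \ (J ∪ J^⊥)`. -/
def IsComponent (cs : CoxeterSystem M W) (J C : Set B) : Prop :=
  ∃ c : ((definingGraph cs).induce ((J ∪ perp cs J)ᶜ)).ConnectedComponent,
    C = Subtype.val '' c.supp

/-- `J` (irreducible spherical) weakly separates `S`: there is a partition of `S \ (J ∪ J^⊥)` into
two non-empty parts such that no element of one part is adjacent to an element of the other. -/
def WeaklySeparates (cs : CoxeterSystem M W) (J : Set B) : Prop :=
  IsIrreducible cs J ∧ IsSpherical cs J ∧
    ∃ A A' : Set B, A.Nonempty ∧ A'.Nonempty ∧ Disjoint A A' ∧ A ∪ A' = (J ∪ perp cs J)ᶜ ∧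
      ∀ a ∈ A, ∀ b ∈ A', ¬ (definingGraph cs).Adj a b

/-- `S` is angle-compatible with `S'`: for all `s, t ∈ S` (possibly equal) with `⟨s, t⟩` finite,
the set `{s, t}` is conjugate to some `{s', t'} ⊆ S'`. -/
def IsAngleCompatible {B' : Type*} {M' : CoxeterMatrix B'} (cs : CoxeterSystem M W)
    (cs' : CoxeterSystem M' W) : Prop :=
  ∀ s t : B, IsSpherical cs {s, t} → ∃ (g : W) (s' t' : B'),
    (fun x => g * x * g⁻¹) '' ({cs.simple s, cs.simple t} : Set W)
      = {cs'.simple s', cs'.simple t'}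

end Combinatorics

section DavisComplex

variable {B W : Type*} [Group W] {M : CoxeterMatrix B}

/-- A (closed) cell of the Davis complex: a left coset `g W_J` with `W_J` finite, as a set of
chambers. Faces of cells correspond to inclusions of cosets. -/
def Cell (cs : CoxeterSystem M W) : Type _ :=
  {D : Set W // ∃ (g : W) (J : Set B), IsSpherical cs J ∧ D = g • (parabolic cs J : Set W)}

instance (cs : CoxeterSystem M W) : PartialOrder (Cell cs) :=
  inferInstanceAs (PartialOrder
    {D : Set W // ∃ (g : W) (J : Set B), IsSpherical cs J ∧ D = g • (parabolic cs J : Set W)})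

/-- The action of `W` on the cells by left translation of cosets. -/
instance (cs : CoxeterSystem M W) : MulAction W (Cell cs) where
  smul g D := ⟨g • D.1, by
    obtain ⟨h, J, hJ, hD⟩ := D.2
    exact ⟨g * h, J, hJ, by rw [hD, mul_smul]⟩⟩
  one_smul D := Subtype.ext (one_smul W D.1)
  mul_smul g h D := Subtype.ext (mul_smul g h D.1)

theorem smul_le_smul_cell (cs : CoxeterSystem M W) (g : W) {D E : Cell cs} (h : D ≤ E) :
    g • D ≤ g • E :=
  Set.smul_set_mono (show D.1 ⊆ E.1 from h)

/-- A point of the Davis complex `𝔸`, described in the barycentric subdivision of `𝔸`, which is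
the geometric realisation of the poset of cells: a point is given by its barycentric coordinates,
which are non-negative, have sum `1`, and are supported on a finite chain of cells. -/
structure Point (cs : CoxeterSystem M W) where
  coord : Cell cs → ℝ
  finite_support : coord.support.Finite
  isChain_support : IsChain (· ≤ ·) coord.support
  nonneg : ∀ D, 0 ≤ coord D
  sum_eq_one : ∑ᶠ D, coord D = 1

theorem Point.ext' {cs : CoxeterSystem M W} {x y : Point cs} (h : x.coord = y.coord) : x = y := by
  cases x; cases y; cases h; rfl

/-- The closed simplex of the barycentric subdivision spanned by a finite chain `σ` of cells. -/
def ClosedSimplex (cs : CoxeterSystem M W)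
    (σ : {σ : Finset (Cell cs) // IsChain (· ≤ ·) (σ : Set (Cell cs))}) : Type _ :=
  {x : Point cs // x.coord.support ⊆ (σ.1 : Set (Cell cs))}

/-- The Davis complex carries the usual (weak) topology of a complex: a set is open if and only if
it meets every closed simplex in an open subset of this simplex, where a closed simplex has the
Euclidean topology, given by its (finitely many non-zero) barycentric coordinates. -/
instance (cs : CoxeterSystem M W) : TopologicalSpace (Point cs) :=
  ⨆ σ : {σ : Finset (Cell cs) // IsChain (· ≤ ·) (σ : Set (Cell cs))},
    TopologicalSpace.coinduced (fun x : ClosedSimplex cs σ => x.1)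
      (TopologicalSpace.induced (fun x : ClosedSimplex cs σ => x.1.coord) inferInstance)

/-- The action of `W` on the Davis complex. -/
instance (cs : CoxeterSystem M W) : MulAction W (Point cs) where
  smul g x :=
    { coord := fun D => x.coord (g⁻¹ • D)
      finite_support :=
        x.finite_support.preimage ((MulAction.injective (β := Cell cs) g⁻¹).injOn)
      isChain_support := by
        intro D hD E hE hne
        have h := x.isChain_support (x := g⁻¹ • D) hD (y := g⁻¹ • E) hE
          (fun h => hne (MulAction.injective g⁻¹ h))
        rcases h with h | h
        · left
          have := smul_le_smul_cell cs g h
          rwa [smul_inv_smul, smul_inv_smul] at this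
        · right
          have := smul_le_smul_cell cs g h
          rwa [smul_inv_smul, smul_inv_smul] at this
      nonneg := fun D => x.nonneg _
      sum_eq_one := by
        rw [← x.sum_eq_one]
        exact finsum_comp_equiv (MulAction.toPerm (β := Cell cs) g⁻¹) }
  one_smul x := Point.ext' (funext fun D => by
    change x.coord ((1 : W)⁻¹ • D) = x.coord D
    rw [inv_one, one_smul])
  mul_smul g h x := Point.ext' (funext fun D => by
    change x.coord ((g * h)⁻¹ • D) = x.coord (h⁻¹ • g⁻¹ • D)
    rw [mul_inv_rev, mul_smul])

/-- The cell of dimension zero `{g} = g W_∅`. -/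
def vertexCell (cs : CoxeterSystem M W) (g : W) : Cell cs :=
  ⟨{g}, g, ∅, by simp [IsSpherical, parabolic], by simp [parabolic]⟩

open Classical in
/-- The vertex (chamber) of the Davis complex corresponding to `g`. -/
noncomputable def vertex (cs : CoxeterSystem M W) (g : W) : Point cs where
  coord := Pi.single (vertexCell cs g) 1
  finite_support := (Set.finite_singleton (vertexCell cs g)).subset Pi.support_single_subset
  isChain_support := (Set.subsingleton_singleton.anti Pi.support_single_subset).isChain
  nonneg D := by
    by_cases h : D = vertexCell cs g
    · subst h; simp
    · simp [h]
  sum_eq_one := by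
    rw [finsum_eq_single _ (vertexCell cs g) (fun D hD => by simp [hD])]
    simp

/-- The wall of the reflection `r`: its fixed-point set in the Davis complex. -/
def wall (cs : CoxeterSystem M W) (r : W) : Set (Point cs) :=
  {x | r • x = x}

/-- A half-space for the reflection `r`: a connected component of the complement of its wall. -/
def IsHalfSpace (cs : CoxeterSystem M W) (r : W) (Φ : Set (Point cs)) : Prop :=
  ∃ x ∈ (wall cs r)ᶜ, Φ = connectedComponentIn (wall cs r)ᶜ x

/-- The wall of `r` separates the chambers `c` and `d`: no half-space for `r` contains both. -/
def WallSeparates (cs : CoxeterSystem M W) (r c d : W) : Prop :=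
  ¬ ∃ Φ, IsHalfSpace cs r Φ ∧ vertex cs c ∈ Φ ∧ vertex cs d ∈ Φ

/-- The chamber `c` is incident to the wall of `r`: it is an endpoint of an edge `{c, c sᵢ}` crossed
by the wall, that is, an edge whose endpoints are interchanged by `r`. -/
def IsIncident (cs : CoxeterSystem M W) (r c : W) : Prop :=
  ∃ i : B, r * c = c * cs.simple i

/-- The distance of the chamber `c` from the wall of `r`: the minimal gallery distance
`d(c, c') = ℓ(c⁻¹ c')` from `c` to a chamber `c'` incident to the wall. -/
noncomputable def distToWall (cs : CoxeterSystem M W) (r c : W) : ℕ :=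
  sInf {n | ∃ c' : W, IsIncident cs r c' ∧ cs.length (c⁻¹ * c') = n}

end DavisComplex

section Markings

variable {B W : Type*} [Group W] {M : CoxeterMatrix B}

/-- `(s, w)` is a base with core `s` and support `J`. The base chamber `c₀` is the identity. -/
def IsBase (cs : CoxeterSystem M W) (s : B) (w : W) (J : Set B) : Prop :=
  ∃ l : List B, l.Nodup ∧ s ∉ l ∧ w = cs.wordProd l ∧
    distToWall cs (cs.simple s) w = l.length ∧
    (∀ r, cs.IsReflection r → WallSeparates cs r w 1 →
      (wall cs r ∩ wall cs (cs.simple s)).Nonempty) ∧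
    J = insert s {j | j ∈ l} ∧ IsSpherical cs J

/-- A marking `((s, w), m)`: a base `(s, w)` together with its support `J`, and a marker `m`
which is not adjacent to some element `j` of `J`, in the sense that `{m, j}` is not spherical
(in particular `m ∉ J`). -/
structure Marking (cs : CoxeterSystem M W) where
  core : B
  elt : W
  support : Set B
  isBase : IsBase cs core elt support
  marker : B
  marker_spec : ∃ j ∈ support, ¬ IsSpherical cs {marker, j}

/-- Move M1: common core, same support, adjacent markers. -/
def MoveOne {cs : CoxeterSystem M W} (μ ν : Marking cs) : Prop :=
  μ.core = ν.core ∧ μ.support = ν.support ∧ (definingGraph cs).Adj μ.marker ν.marker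

/-- Move M2: common core, same marker, and the first support is obtained from the second one by
adding an element adjacent to the marker. -/
def MoveTwo {cs : CoxeterSystem M W} (μ ν : Marking cs) : Prop :=
  μ.core = ν.core ∧ μ.marker = ν.marker ∧
    ∃ j : B, μ.support = ν.support ∪ {j} ∧ (definingGraph cs).Adj μ.marker j

/-- `μ ∼ ν`: there is a finite (possibly empty) sequence of moves M1 or M2, performed in either
direction, from `μ` to `ν`. -/
def MoveEquiv {cs : CoxeterSystem M W} (μ ν : Marking cs) : Prop :=
  Relation.EqvGen (fun μ ν : Marking cs => MoveOne μ ν ∨ MoveTwo μ ν) μ ν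

/-- The set `K` associated with a marking with support `J ⊇ I` and marker `m`:
`J \ (I ∪ I^⊥)` if `I ⊊ J`, and `{m}` if `J = I`. -/
def Marking.relSet {cs : CoxeterSystem M W} (μ : Marking cs) (I : Set B) : Set B :=
  {k | (I ⊂ μ.support ∧ k ∈ μ.support \ (I ∪ perp cs I)) ∨ (μ.support = I ∧ k = μ.marker)}

/-- `Φ` is a half-space in the Davis complex of the second (ambient) Coxeter system for the core
`s` of `μ = ((s, w), m)`, and it contains the translate by `w` of the wall of the marker `m`. -/
def IsMarkingHalfSpace {B' : Type*} {M' : CoxeterMatrix B'} {cs : CoxeterSystem M W}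
    (cs' : CoxeterSystem M' W) (μ : Marking cs) (Φ : Set (Point cs')) : Prop :=
  IsHalfSpace cs' (cs.simple μ.core) Φ ∧ μ.elt • wall cs' (cs.simple μ.marker) ⊆ Φ

end Markings

end CoxDavis

/-! The element `w` of a base is determined by its core `s` and support `J`. Bases correspond to
growths of `J` from `s`, adding one generator at a time, each not commuting with an earlier one
(`isBase_iff`). In the geometric representation the root `w⁻¹ α_s` has coefficients at least 1 on
`J` and 0 elsewhere. A new generator with two non-commuting partners in `J` would have scalar
product at most -1 with this root, giving an element of infinite order. So in a spherical set each
new generator has exactly one partner, and all growth orders give the same product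
(`IsGrowth.unique`).

The same estimate, with a marker at exponent ∞ from an element of `J`, makes the wall of `s`
disjoint from `w 𝒲_m`. As walls are path connected (`isPathConnected_wall`), `w 𝒲_m` lies in exactly
one half-space. Both moves preserve this half-space because the two translated walls meet: by
angle-compatibility the walls of adjacent generators have a common point, and for M2 such a point is
fixed by the added generator.

Move equivalence is proved by induction on spherical sets from larger to smaller, which is well
founded by type FC. A path in the component `C` is followed vertex by vertex. Markings directed
towards the same vertex `x` either coincide or both have support containing `I ∪ {x}`. The latter
case is the induction hypothesis, since `I ∪ {x}` does not weakly separate and so leaves only one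
component. Markings directed towards adjacent vertices are linked by M1, by M2, or through a marking
whose support contains `I` and both vertices. -/

namespace CoxDavis

/-! ### Geometric representation and products of reflections of infinite order. -/

section GeometricRepresentation

variable {B W : Type*} [Group W] {M : CoxeterMatrix B}

/-- The linear form `v ↦ ⟨v, α_a⟩` on the space with basis the simple roots. -/
noncomputable def cosForm (M : CoxeterMatrix B) (a : B) : Module.Dual ℝ (B →₀ ℝ) :=
  Finsupp.linearCombination ℝ (fun i => -Real.cos (Real.pi / M i a))

/-- The entry `0` encodes ∞, and `π / 0 = 0`, so such pairs of simple roots get the usual product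
-1. -/
theorem cosForm_single (M : CoxeterMatrix B) (a i : B) (c : ℝ) :
    cosForm M a (Finsupp.single i c) = c * -Real.cos (Real.pi / M i a) := by
  simp [cosForm]

theorem two_cosForm_self (M : CoxeterMatrix B) (a : B) :
    ((2 : ℝ) • cosForm M a) (Finsupp.single a 1) = 2 := by
  simp [cosForm_single]

/-- The bilinear form associated with a Coxeter matrix. -/
noncomputable def cosBilin (M : CoxeterMatrix B) : (B →₀ ℝ) →ₗ[ℝ] Module.Dual ℝ (B →₀ ℝ) :=
  Finsupp.linearCombination ℝ (cosForm M)

theorem cosBilin_single (M : CoxeterMatrix B) (a : B) (v : B →₀ ℝ) :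
    cosBilin M (Finsupp.single a 1) v = cosForm M a v := by
  simp [cosBilin]

theorem cosBilin_comm (M : CoxeterMatrix B) (u v : B →₀ ℝ) :
    cosBilin M u v = cosBilin M v u := by
  have h : cosBilin M = (cosBilin M).flip := by
    ext i j
    simp [cosBilin_single, cosForm_single, M.symmetric i j]
  conv_lhs => rw [h]
  rfl

/-- The reflection in the simple root `α_a`. -/
noncomputable def rootReflection (M : CoxeterMatrix B) (a : B) : (B →₀ ℝ) ≃ₗ[ℝ] (B →₀ ℝ) :=
  Module.reflection (two_cosForm_self M a)

theorem rootReflection_apply (M : CoxeterMatrix B) (a : B) (v : B →₀ ℝ) :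
    rootReflection M a v = v - (2 * cosForm M a v) • Finsupp.single a 1 := by
  simp [rootReflection, Module.reflection_apply]

theorem rootReflection_self (M : CoxeterMatrix B) (a : B) :
    rootReflection M a (Finsupp.single a 1) = -Finsupp.single a 1 := by
  simp [rootReflection]

theorem cosBilin_rootReflection (M : CoxeterMatrix B) (a : B) (u v : B →₀ ℝ) :
    cosBilin M (rootReflection M a u) (rootReflection M a v) = cosBilin M u v := by
  have h (w : B →₀ ℝ) : cosBilin M w (Finsupp.single a 1) = cosForm M a w := by
    rw [cosBilin_comm, cosBilin_single]
  simp only [rootReflection_apply, map_sub, map_smul, LinearMap.sub_apply, LinearMap.smul_apply,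
    cosBilin_single, h, cosForm_single, smul_eq_mul]
  simp
  ring

/-- Powers of a product of two reflections are given by Chebyshev polynomials `S_n` at `2 cos θ`, `θ
= 2π/m`, whose values are `sin ((n+1)θ) / sin θ`. For `m = 2k` the value of `S_{k-1}` vanishes; for
`m = 2k+1` those of `S_k` and `S_{k-1}` cancel. -/
theorem rootReflection_mul_pow (M : CoxeterMatrix B) (a b : B) :
    (rootReflection M a * rootReflection M b) ^ M a b = 1 := by
  obtain rfl | hab := eq_or_ne a b
  · rw [M.diagonal, pow_one]
    ext1 z
    exact Module.involutive_reflection (two_cosForm_self M a) z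
  obtain h0 | h0 := eq_or_ne (M a b) 0
  · rw [h0, pow_zero]
  have h1 : M a b ≠ 1 := M.off_diagonal a b hab
  ext1 z
  obtain ⟨m, hm⟩ : ∃ m, m = M a b := ⟨_, rfl⟩
  rw [← hm] at h0 h1 ⊢
  have ht : 2 * Real.cos (2 * Real.pi / m) = ((2 : ℝ) • cosForm M a) (Finsupp.single b 1) *
      ((2 : ℝ) • cosForm M b) (Finsupp.single a 1) - 2 := by
    have h := Real.cos_two_mul (Real.pi / m)
    rw [mul_div_assoc, h]
    simp [cosForm_single, ← hm, M.symmetric b a]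
    ring
  rw [rootReflection, rootReflection, LinearEquiv.coe_one, id]
  rw [Module.reflection_mul_reflection_pow_apply (two_cosForm_self M a) (two_cosForm_self M b) m z
    (2 * Real.cos (2 * Real.pi / m)) ht]
  -- The quotient formula fails for `m = 2`, where `sin θ = 0`.
  obtain rfl | hm2 := eq_or_ne m 2
  · norm_num [Polynomial.Chebyshev.S_neg_one, cosForm_single, ← hm, M.symmetric b a]
    abel
  have hm3 : (3 : ℝ) ≤ m := by
    exact_mod_cast (by omega : 3 ≤ m)
  have hsin : Real.sin (2 * Real.pi / m) ≠ 0 := by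
    apply ne_of_gt
    apply Real.sin_pos_of_pos_of_lt_pi
    · positivity
    · rw [div_lt_iff₀ (by linarith)]
      nlinarith [Real.pi_pos]
  have key (n : ℤ) : ((Polynomial.Chebyshev.S ℝ n).eval (2 * Real.cos (2 * Real.pi / m))) =
      Real.sin ((n + 1) * (2 * Real.pi / m)) / Real.sin (2 * Real.pi / m) := by
    rw [eq_div_iff hsin, Polynomial.Chebyshev.S_two_mul_real_cos]
  obtain ⟨k, hk | hk⟩ := Nat.even_or_odd' m
  · have e1 : ((m : ℤ) - 2) / 2 = k - 1 := by omega
    have e2 : ((m : ℤ) - 1) / 2 = k - 1 := by omega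
    have e : Polynomial.eval (2 * Real.cos (2 * Real.pi / m))
        (Polynomial.Chebyshev.S ℝ ((k : ℤ) - 1)) = 0 := by
      rw [key]
      have : ((((k : ℤ) - 1 : ℤ) : ℝ) + 1) * (2 * Real.pi / m) = Real.pi := by
        rw [hk] at hm3 ⊢
        push_cast at hm3 ⊢
        have hk0 : (k : ℝ) ≠ 0 := by intro h; rw [h] at hm3; norm_num at hm3
        field_simp
        ring
      rw [this]; simp
    rw [e1, e2, e]; simp
  · have e1 : ((m : ℤ) - 2) / 2 = k - 1 := by omega
    have e2 : ((m : ℤ) - 1) / 2 = k := by omega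
    have e3 : ((m : ℤ) - 3) / 2 = k - 1 := by omega
    have e4 : (m : ℤ) / 2 = k := by omega
    have e : Polynomial.eval (2 * Real.cos (2 * Real.pi / m))
        (Polynomial.Chebyshev.S ℝ (k : ℤ)) + Polynomial.eval (2 * Real.cos (2 * Real.pi / m))
        (Polynomial.Chebyshev.S ℝ ((k : ℤ) - 1)) = 0 := by
      rw [key, key, ← add_div]
      have : (((k : ℤ) : ℝ) + 1) * (2 * Real.pi / m) =
          2 * Real.pi - ((((k : ℤ) - 1 : ℤ) : ℝ) + 1) * (2 * Real.pi / m) := by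
        rw [hk] at hm3 ⊢
        push_cast at hm3 ⊢
        field_simp
        ring
      rw [this, Real.sin_two_pi_sub]; simp
    rw [e1, e2, e3, e4, e]; simp

/-- The geometric representation of a Coxeter group. -/
noncomputable def geomRep (cs : CoxeterSystem M W) : W →* ((B →₀ ℝ) ≃ₗ[ℝ] (B →₀ ℝ)) :=
  cs.lift ⟨rootReflection M, fun a b => rootReflection_mul_pow M a b⟩

theorem geomRep_simple (cs : CoxeterSystem M W) (a : B) :
    geomRep cs (cs.simple a) = rootReflection M a :=
  cs.lift_apply_simple _ a

theorem cosBilin_geomRep (cs : CoxeterSystem M W) (w : W) (u v : B →₀ ℝ) :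
    cosBilin M (geomRep cs w u) (geomRep cs w v) = cosBilin M u v := by
  induction w using cs.simple_induction_left generalizing u v with
  | one => simp
  | mul_simple_left w i ih =>
    simp only [map_mul, LinearEquiv.mul_apply, geomRep_simple, cosBilin_rootReflection, ih]

theorem simple_injective (cs : CoxeterSystem M W) : Function.Injective cs.simple := by
  intro i j hij
  by_contra hne
  have h : rootReflection M i (Finsupp.single i 1) = rootReflection M j (Finsupp.single i 1) := by
    rw [← geomRep_simple cs, ← geomRep_simple cs, hij]
  rw [rootReflection_self, rootReflection_apply] at h
  have := DFunLike.congr_fun h i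
  simp [Ne.symm hne] at this
  linarith

/-- The action of a reflection on a vector. -/
theorem geomRep_conj_apply (cs : CoxeterSystem M W) (u : W) (s : B) (v : B →₀ ℝ) :
    geomRep cs (u * cs.simple s * u⁻¹) v =
      v - (2 * cosBilin M (geomRep cs u (Finsupp.single s 1)) v) •
        geomRep cs u (Finsupp.single s 1) := by
  have h : cosForm M s (geomRep cs u⁻¹ v) = cosBilin M (geomRep cs u (Finsupp.single s 1)) v := by
    rw [← cosBilin_single, ← cosBilin_geomRep cs u, ← LinearEquiv.mul_apply, ← map_mul]
    simp
  simp only [map_mul, LinearEquiv.mul_apply, geomRep_simple, rootReflection_apply, map_sub,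
    map_smul, h]
  rw [← LinearEquiv.mul_apply, ← map_mul]
  simp

/-- Two reflections whose roots have scalar product at most `-1` have a product of infinite
order. -/
theorem not_isOfFinOrder_of_cosBilin_le (cs : CoxeterSystem M W) (u : W) (s m k : B)
    (hle : cosForm M m (geomRep cs u (Finsupp.single s 1)) ≤ -1)
    (hk : geomRep cs u (Finsupp.single s 1) k ≠ 0) (hkm : k ≠ m) :
    ¬ IsOfFinOrder (u * cs.simple s * u⁻¹ * cs.simple m) := by
  set β := geomRep cs u (Finsupp.single s 1) with hβ
  set α : B →₀ ℝ := Finsupp.single m 1 with hα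
  set c := -cosForm M m β with hc
  have hc1 : 1 ≤ c := by linarith
  have hββ : cosBilin M β β = 1 := by
    rw [hβ, cosBilin_geomRep, cosBilin_single, cosForm_single]; simp
  have hβα : cosBilin M β α = -c := by
    rw [cosBilin_comm, hα, cosBilin_single]; simp [c]
  have hfα : cosForm M m α = 1 := by rw [hα, cosForm_single]; simp
  have hstep (p q : ℝ) : geomRep cs (u * cs.simple s * u⁻¹ * cs.simple m) (p • β + q • α) =
      (2 * c * (2 * c * p - q) - p) • β + (2 * c * p - q) • α := by
    rw [map_mul, LinearEquiv.mul_apply, geomRep_conj_apply, ← hβ, geomRep_simple,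
      rootReflection_apply, ← hα]
    simp only [map_add, map_sub, map_smul, hfα, hββ, hβα, smul_eq_mul]
    have : cosForm M m β = -c := by simp [c]
    rw [this]
    module
  -- Since `2c ≥ 2`, the inequality `q < p` persists and `p` strictly increases, so no positive
  -- power can fix `β`.
  have hpow (n : ℕ) : ∃ p q : ℝ, 0 ≤ q ∧ q < p ∧ (1 ≤ p) ∧ (0 < n → 1 < p) ∧
      geomRep cs ((u * cs.simple s * u⁻¹ * cs.simple m) ^ n) β = p • β + q • α := by
    induction n with
    | zero => exact ⟨1, 0, le_rfl, one_pos, le_rfl, by simp, by simp⟩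
    | succ n ih =>
      obtain ⟨p, q, hq, hqp, hp1, -, h⟩ := ih
      have h1 : p < 2 * c * p - q := by nlinarith
      have h2 : 2 * c * p - q < 2 * c * (2 * c * p - q) - p := by nlinarith
      refine ⟨_, _, ?_, h2, ?_, ?_, ?_⟩
      · linarith
      · linarith
      · intro; linarith
      · rw [pow_succ', map_mul, LinearEquiv.mul_apply, h, hstep]
  rw [isOfFinOrder_iff_pow_eq_one]
  rintro ⟨n, hn, h1⟩
  obtain ⟨p, q, -, -, -, hp, h⟩ := hpow n
  rw [h1, map_one, LinearEquiv.coe_one, id] at h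
  -- The coordinate `k ≠ m` does not see `α`, so it compares `p` with 1.
  have := DFunLike.congr_fun h k
  simp [hα, hkm] at this
  have := hp hn
  have h3 : (p - 1) * β k = 0 := by linarith
  rcases mul_eq_zero.1 h3 with h4 | h4
  · linarith
  · exact hk h4

end GeometricRepresentation

/-! ### Growths, their roots, and the distance to the wall of the core. -/

section Growth

variable {B W : Type*} [Group W] {M : CoxeterMatrix B}

theorem commute_of_eq_two (cs : CoxeterSystem M W) {a b : B} (h : M a b = 2) :
    Commute (cs.simple a) (cs.simple b) := by
  have h1 := cs.simple_mul_simple_pow a b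
  rw [h, pow_two, mul_eq_one_iff_eq_inv] at h1
  exact (by simpa using h1 : cs.simple a * cs.simple b = cs.simple b * cs.simple a)

theorem cos_pi_div_nonneg (M : CoxeterMatrix B) {a b : B} (h : a ≠ b) :
    0 ≤ Real.cos (Real.pi / M a b) := by
  obtain h0 | h0 := eq_or_ne (M a b) 0
  · simp [h0]
  have h2 : (2 : ℝ) ≤ M a b := by
    have := M.off_diagonal a b h
    exact_mod_cast (by omega : 2 ≤ M a b)
  apply Real.cos_nonneg_of_neg_pi_div_two_le_of_le
  · have : 0 ≤ Real.pi / M a b := by positivity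
    linarith [Real.pi_pos]
  · gcongr

theorem half_le_cos_pi_div (cs : CoxeterSystem M W) {a b : B}
    (h : ¬ Commute (cs.simple a) (cs.simple b)) : 1 / 2 ≤ Real.cos (Real.pi / M a b) := by
  have hab : a ≠ b := by rintro rfl; exact h (Commute.refl _)
  obtain h0 | h0 := eq_or_ne (M a b) 0
  · simp [h0]; norm_num
  have h3 : (3 : ℝ) ≤ M a b := by
    have := M.off_diagonal a b hab
    have : M a b ≠ 2 := fun h2 => h (commute_of_eq_two cs h2)
    exact_mod_cast (by omega : 3 ≤ M a b)
  rw [← Real.cos_pi_div_three]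
  apply Real.cos_le_cos_of_nonneg_of_le_pi
  · positivity
  · linarith [Real.pi_pos]
  · gcongr

/-- Every term of the form is non-positive, so discarding those outside `T` can only increase the
sum. -/
theorem cosForm_le_sum (M : CoxeterMatrix B) (a : B) (v : B →₀ ℝ) (hv : ∀ i, 0 ≤ v i)
    (ha : v a = 0) (T : Finset B) :
    cosForm M a v ≤ ∑ i ∈ T, v i * -Real.cos (Real.pi / M i a) := by
  classical
  rw [cosForm, Finsupp.linearCombination_apply,
    Finsupp.sum_of_support_subset v (s := v.support ∪ T) Finset.subset_union_left _ (by simp),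
    ← Finset.sum_sdiff (Finset.subset_union_right : T ⊆ v.support ∪ T)]
  simp only [smul_eq_mul]
  rw [add_le_iff_nonpos_left]
  refine Finset.sum_nonpos fun i _ => ?_
  obtain rfl | hia := eq_or_ne i a
  · simp [ha]
  · have := mul_nonneg (hv i) (cos_pi_div_nonneg M hia)
    linarith

/-- `IsGrowth cs s J w`: the set `J` is built up from `s` by adding one generator at a time, each
of them not commuting with one of the preceding generators, and `w` is the product of the added
generators. -/
inductive IsGrowth (cs : CoxeterSystem M W) (s : B) : Set B → W → Prop
  | base : IsGrowth cs s {s} 1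
  | step {J : Set B} {w : W} {a : B} : IsGrowth cs s J w → a ∉ J →
      (∃ b ∈ J, ¬ Commute (cs.simple a) (cs.simple b)) →
      IsGrowth cs s (insert a J) (w * cs.simple a)

theorem IsGrowth.mem {cs : CoxeterSystem M W} {s : B} {J : Set B} {w : W}
    (h : IsGrowth cs s J w) : s ∈ J := by
  induction h with
  | base => exact rfl
  | step _ _ _ ih => exact Set.mem_insert_of_mem _ ih

theorem simple_mem_parabolic (cs : CoxeterSystem M W) {J : Set B} {j : B} (hj : j ∈ J) :
    cs.simple j ∈ parabolic cs J :=
  Subgroup.subset_closure ⟨j, hj, rfl⟩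

theorem parabolic_mono (cs : CoxeterSystem M W) {J K : Set B} (h : J ⊆ K) :
    parabolic cs J ≤ parabolic cs K :=
  Subgroup.closure_mono (Set.image_mono h)

theorem IsSpherical.mono {cs : CoxeterSystem M W} {J K : Set B} (hK : IsSpherical cs K)
    (h : J ⊆ K) : IsSpherical cs J :=
  Set.Finite.subset hK (parabolic_mono cs h)

theorem IsSpherical.finite {cs : CoxeterSystem M W} {J : Set B} (hJ : IsSpherical cs J) :
    J.Finite :=
  Set.Finite.of_finite_image (hJ.subset (Subgroup.subset_closure : cs.simple '' J ⊆ _))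
    (simple_injective cs).injOn

theorem IsSpherical.isOfFinOrder {cs : CoxeterSystem M W} {J : Set B} (hJ : IsSpherical cs J)
    {x : W} (hx : x ∈ parabolic cs J) : IsOfFinOrder x := by
  have : Finite (parabolic cs J) := hJ
  have h := isOfFinOrder_of_finite (⟨x, hx⟩ : parabolic cs J)
  exact (parabolic cs J).subtype.isOfFinOrder h

theorem IsGrowth.elt_mem {cs : CoxeterSystem M W} {s : B} {J : Set B} {w : W}
    (h : IsGrowth cs s J w) : w ∈ parabolic cs J := by
  induction h with
  | base => exact one_mem _
  | step _ _ _ ih =>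
    exact mul_mem (parabolic_mono cs (Set.subset_insert _ _) ih)
      (simple_mem_parabolic cs (Set.mem_insert _ _))

/-- Reflecting in `α_a` changes only the `a`-coordinate, from 0 to `-2⟨β, α_a⟩`. This is at least 1,
because the partner `b` alone contributes at most `-1/2` to the scalar product. -/
theorem IsGrowth.root {cs : CoxeterSystem M W} {s : B} {J : Set B} {w : W}
    (h : IsGrowth cs s J w) :
    (∀ j ∈ J, 1 ≤ geomRep cs w⁻¹ (Finsupp.single s 1) j) ∧
      ∀ j ∉ J, geomRep cs w⁻¹ (Finsupp.single s 1) j = 0 := by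
  induction h with
  | base =>
    constructor
    · rintro j rfl; simp
    · intro j hj; simp [show s ≠ j from fun h => hj h.symm]
  | @step J w a _ ha hb ih =>
    obtain ⟨b, hbJ, hab⟩ := hb
    set β := geomRep cs w⁻¹ (Finsupp.single s 1) with hβ
    have e : geomRep cs (w * cs.simple a)⁻¹ (Finsupp.single s 1) =
        β - (2 * cosForm M a β) • Finsupp.single a 1 := by
      rw [mul_inv_rev, map_mul, LinearEquiv.mul_apply, cs.inv_simple, geomRep_simple,
        rootReflection_apply]
    have hβ0 : ∀ i, 0 ≤ β i := fun i => by
      by_cases hi : i ∈ J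
      · linarith [ih.1 i hi]
      · exact (ih.2 i hi).ge
    have hle := cosForm_le_sum M a β hβ0 (ih.2 a ha) {b}
    have hcos := half_le_cos_pi_div cs hab
    rw [M.symmetric] at hcos
    rw [Finset.sum_singleton] at hle
    have hb1 := ih.1 b hbJ
    have hcf : cosForm M a β ≤ -(1 / 2) := by nlinarith
    rw [e]
    constructor
    · rintro j (rfl | hj)
      · simp [ih.2 _ ha]; linarith
      · have : a ≠ j := by rintro rfl; exact ha hj
        simpa [this] using ih.1 j hj
    · intro j hj
      rw [Set.mem_insert_iff, not_or] at hj
      simp [Ne.symm hj.1, ih.2 j hj.2]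

/-- The bound on the cosines forces `⟨w⁻¹ α_s, α_m⟩ ≤ -1`. It holds when `T` is one element with
exponent ∞, or two elements not commuting with `m`. -/
theorem IsGrowth.not_isOfFinOrder {cs : CoxeterSystem M W} {s : B} {J : Set B} {w : W}
    (h : IsGrowth cs s J w) {m : B} (hm : m ∉ J) (T : Finset B) (hTJ : ∀ i ∈ T, i ∈ J)
    (hT : 1 ≤ ∑ i ∈ T, Real.cos (Real.pi / M i m)) :
    ¬ IsOfFinOrder (w⁻¹ * cs.simple s * w * cs.simple m) := by
  have hr := h.root
  have := not_isOfFinOrder_of_cosBilin_le cs w⁻¹ s m s ?_ ?_ ?_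
  · simpa using this
  · refine (cosForm_le_sum M m _ (fun i => ?_) (hr.2 m hm) T).trans ?_
    · by_cases hi : i ∈ J
      · linarith [hr.1 i hi]
      · exact (hr.2 i hi).ge
    · have : ∑ i ∈ T, Real.cos (Real.pi / M i m) ≤
          ∑ i ∈ T, geomRep cs w⁻¹ (Finsupp.single s 1) i * Real.cos (Real.pi / M i m) := by
        refine Finset.sum_le_sum fun i hi => ?_
        have him : i ≠ m := by rintro rfl; exact hm (hTJ _ hi)
        have h0 := cos_pi_div_nonneg M him
        have h1 := hr.1 i (hTJ i hi)
        nlinarith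
      simp only [mul_neg, Finset.sum_neg_distrib]
      linarith
  · linarith [hr.1 s h.mem]
  · rintro rfl; exact hm h.mem

theorem not_isOfFinOrder_of_eq_zero (cs : CoxeterSystem M W) {a b : B} (h : M a b = 0) :
    ¬ IsOfFinOrder (cs.simple a * cs.simple b) := by
  have hab : b ≠ a := by rintro rfl; simp at h
  have := (IsGrowth.base (cs := cs) (s := a)).not_isOfFinOrder (m := b) hab {a} (by simp)
    (by simp [h])
  simpa using this

theorem ne_zero_of_isSpherical {cs : CoxeterSystem M W} {J : Set B} (hJ : IsSpherical cs J)
    {a b : B} (ha : a ∈ J) (hb : b ∈ J) : M a b ≠ 0 := fun h =>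
  not_isOfFinOrder_of_eq_zero cs h
    (hJ.isOfFinOrder (mul_mem (simple_mem_parabolic cs ha) (simple_mem_parabolic cs hb)))

theorem isSpherical_iff {cs : CoxeterSystem M W} (hFC : IsTypeFC cs) {J : Set B} :
    IsSpherical cs J ↔ ∀ a ∈ J, ∀ b ∈ J, M a b ≠ 0 :=
  ⟨fun h _ ha _ hb => ne_zero_of_isSpherical h ha hb, fun h => hFC J h⟩

theorem isSpherical_pair_iff {cs : CoxeterSystem M W} (hFC : IsTypeFC cs) {a b : B} :
    IsSpherical cs {a, b} ↔ M a b ≠ 0 := by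
  rw [isSpherical_iff hFC]
  constructor
  · intro h; exact h a (by simp) b (by simp)
  · rintro h x (rfl | rfl) y (rfl | rfl)
    · simp
    · exact h
    · rwa [M.symmetric]
    · simp

theorem not_commute_of_eq_zero (cs : CoxeterSystem M W) {a b : B} (h : M a b = 0) :
    ¬ Commute (cs.simple a) (cs.simple b) := fun hc =>
  not_isOfFinOrder_of_eq_zero cs h (isOfFinOrder_iff_pow_eq_one.2 ⟨2, by norm_num, by
    rw [hc.mul_pow]; simp⟩)

theorem IsGrowth.exists_not_commute {cs : CoxeterSystem M W} {s : B} {J : Set B} {w : W}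
    (h : IsGrowth cs s J w) {a : B} (ha : a ∈ J) (has : a ≠ s) :
    ∃ b ∈ J, ¬ Commute (cs.simple a) (cs.simple b) := by
  induction h with
  | base => exact absurd ha has
  | step _ _ hb ih =>
    obtain rfl | ha := ha
    · exact hb.imp fun b hb => ⟨Set.mem_insert_of_mem _ hb.1, hb.2⟩
    · exact (ih ha).imp fun b hb => ⟨Set.mem_insert_of_mem _ hb.1, hb.2⟩

/-- The only partner of `a` precedes it, so `a` commutes with all generators added later and can be
moved to the end. -/
theorem IsGrowth.remove {cs : CoxeterSystem M W} {s : B} {J : Set B} {w : W}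
    (h : IsGrowth cs s J w) {a : B} (ha : a ∈ J) (has : a ≠ s)
    (huniq : ∀ b ∈ J, ∀ c ∈ J, ¬ Commute (cs.simple a) (cs.simple b) →
      ¬ Commute (cs.simple a) (cs.simple c) → b = c) :
    ∃ v, IsGrowth cs s (J \ {a}) v ∧ w = v * cs.simple a := by
  induction h with
  | base => exact absurd ha has
  | @step J w b hJ hbJ hb ih =>
    obtain rfl | hab := eq_or_ne a b
    · refine ⟨w, ?_, rfl⟩
      rwa [Set.insert_sdiff_self_of_notMem hbJ]
    have haJ : a ∈ J := ha.resolve_left hab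
    obtain ⟨v, hv, rfl⟩ := ih haJ fun b hb c hc =>
      huniq b (Set.mem_insert_of_mem _ hb) c (Set.mem_insert_of_mem _ hc)
    obtain ⟨c, hcJ, hac⟩ := hJ.exists_not_commute haJ has
    have hcomm : Commute (cs.simple a) (cs.simple b) := by
      by_contra hn
      exact hbJ (huniq b (Set.mem_insert _ _) c (Set.mem_insert_of_mem _ hcJ) hn hac ▸ hcJ)
    obtain ⟨d, hdJ, hbd⟩ := hb
    refine ⟨v * cs.simple b, ?_, by rw [mul_assoc, hcomm.eq, mul_assoc]⟩
    rw [Set.insert_sdiff_of_notMem _ (show b ∉ ({a} : Set B) from fun h => hab h.symm)]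
    refine hv.step (fun h => hbJ h.1) ⟨d, ⟨hdJ, ?_⟩, hbd⟩
    rintro rfl
    exact hbd hcomm.symm

/-- The last generator `a` of one growth has a single partner: two would contribute `1/2 + 1/2` and
give an element of infinite order in a finite group. Hence the other growth can be reordered to end
in `a` as well. -/
theorem IsGrowth.unique {cs : CoxeterSystem M W} {s : B} {J : Set B} {w w' : W}
    (h : IsGrowth cs s J w) (h' : IsGrowth cs s J w') (hJ : IsSpherical cs J) : w = w' := by
  classical
  induction h generalizing w' with
  | base =>
    generalize hK : ({s} : Set B) = K at h'
    cases h' with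
    | base => rfl
    | @step J v a hv ha _ =>
      have : a ∈ ({s} : Set B) := hK ▸ Set.mem_insert a J
      rw [Set.mem_singleton_iff] at this
      exact absurd (this ▸ hv.mem) ha
  | @step J w a hw ha hb ih =>
    have has : a ≠ s := by rintro rfl; exact ha hw.mem
    obtain ⟨v, hv, rfl⟩ := h'.remove (Set.mem_insert a J) has fun b hb c hc hab hac => by
      by_contra hbc
      have hbJ : b ∈ J := hb.resolve_left (by rintro rfl; exact hab (Commute.refl _))
      have hcJ : c ∈ J := hc.resolve_left (by rintro rfl; exact hac (Commute.refl _))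
      refine hw.not_isOfFinOrder ha {b, c} (by simp [hbJ, hcJ]) ?_
        (hJ.isOfFinOrder (J := insert a J) ?_)
      · rw [Finset.sum_pair hbc, M.symmetric b, M.symmetric c]
        linarith [half_le_cos_pi_div cs hab, half_le_cos_pi_div cs hac]
      · have h1 := parabolic_mono cs (Set.subset_insert a J) hw.elt_mem
        exact mul_mem (mul_mem (mul_mem (inv_mem h1)
          (simple_mem_parabolic cs (Set.mem_insert_of_mem _ hw.mem))) h1)
          (simple_mem_parabolic cs (Set.mem_insert _ _))
    rw [Set.insert_sdiff_self_of_notMem ha] at hv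
    rw [ih hv (hJ.mono (Set.subset_insert a J))]

theorem IsGrowth.isIrreducible {cs : CoxeterSystem M W} {s : B} {J : Set B} {w : W}
    (h : IsGrowth cs s J w) : IsIrreducible cs J := by
  induction h with
  | base =>
    rintro ⟨K, hK, hKs, -⟩
    exact hK.ne_empty (Set.ssubset_singleton_iff.1 hKs)
  | @step J w a hw ha hb ih =>
    rintro ⟨K, hK, hKJ, hsub⟩
    obtain ⟨b, hbJ, hab⟩ := hb
    by_cases hJK : J ⊆ K
    · have haK : a ∉ K := fun haK => hKJ.2 (Set.insert_subset haK hJK)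
      exact hab (((hsub (Set.mem_insert a J)).resolve_left haK).2 b (hJK hbJ))
    by_cases hne : (K ∩ J).Nonempty
    · refine ih ⟨K ∩ J, hne, ⟨Set.inter_subset_right, fun h => hJK (h.trans Set.inter_subset_left)⟩,
        fun j hj => ?_⟩
      rcases hsub (Set.mem_insert_of_mem _ hj) with h | h
      · exact Or.inl ⟨h, hj⟩
      · exact Or.inr ⟨fun h' => h.1 h'.1, fun k hk => h.2 k hk.1⟩
    · have hKa : ∀ k ∈ K, k = a := fun k hk =>
        (hKJ.1 hk).resolve_right fun hkJ => hne ⟨k, hk, hkJ⟩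
      obtain ⟨k, hk⟩ := hK
      have haK : a ∈ K := hKa k hk ▸ hk
      rcases hsub (Set.mem_insert_of_mem a hbJ) with h | h
      · exact hne ⟨b, h, hbJ⟩
      · exact hab (h.2 a haK).symm

/-- If a maximal growth inside `J` stopped at `K ≠ J`, all of `J \ K` would commute with `K`,
contrary to irreducibility. -/
theorem exists_isGrowth {cs : CoxeterSystem M W} {s : B} {J : Set B} (hs : s ∈ J)
    (hfin : J.Finite) (hirr : IsIrreducible cs J) : ∃ w, IsGrowth cs s J w := by
  have hfin' : {K : Set B | K ⊆ J ∧ ∃ w, IsGrowth cs s K w}.Finite :=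
    hfin.finite_subsets.subset fun K hK => hK.1
  obtain ⟨K, ⟨⟨hKJ, w, hw⟩, hmax⟩⟩ := hfin'.exists_maximal
    ⟨{s}, Set.singleton_subset_iff.2 hs, 1, IsGrowth.base⟩
  obtain rfl | hne := eq_or_ne K J
  · exact ⟨w, hw⟩
  by_contra
  refine hirr ⟨K, ⟨s, hw.mem⟩, hKJ.ssubset_of_ne hne, fun a ha => ?_⟩
  by_contra hn
  rw [Set.mem_union, not_or] at hn
  have : ∃ b ∈ K, ¬ Commute (cs.simple a) (cs.simple b) := by
    by_contra! hc
    exact hn.2 ⟨hn.1, hc⟩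
  exact hn.1 (hmax ⟨Set.insert_subset ha hKJ, _, hw.step hn.1 this⟩ (Set.subset_insert a K)
    (Set.mem_insert a K))

theorem IsGrowth.exists_list {cs : CoxeterSystem M W} {s : B} {J : Set B} {w : W}
    (h : IsGrowth cs s J w) :
    ∃ l : List B, l.Nodup ∧ s ∉ l ∧ w = cs.wordProd l ∧ J = insert s {j | j ∈ l} := by
  induction h with
  | base => exact ⟨[], by simp⟩
  | @step J w a _ ha _ ih =>
    obtain ⟨l, hl, hs, rfl, rfl⟩ := ih
    simp only [Set.mem_insert_iff, Set.mem_ofPred_eq, not_or] at ha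
    refine ⟨l ++ [a], ?_, ?_, ?_, ?_⟩
    · rw [List.nodup_append]
      refine ⟨hl, by simp, ?_⟩
      rintro b hb c hc rfl
      simp only [List.mem_singleton] at hc
      exact ha.2 (hc ▸ hb)
    · simp [hs, Ne.symm ha.1]
    · simp [cs.wordProd_append]
    · ext j; simp; tauto

theorem isIncident_one (cs : CoxeterSystem M W) (s : B) : IsIncident cs (cs.simple s) 1 :=
  ⟨s, by simp⟩

theorem distToWall_le (cs : CoxeterSystem M W) {r w c : W} (hc : IsIncident cs r c) :
    distToWall cs r w ≤ cs.length (w⁻¹ * c) :=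
  Nat.sInf_le ⟨c, hc, rfl⟩

/-- A letter `a` commuting with `s` and all previous letters could be pulled to the front. The
chamber `a.c₀` is incident to the wall of `s`, so the distance would be at most that of the word
with `a` deleted. -/
theorem isGrowth_of_distToWall (cs : CoxeterSystem M W) (s : B) (l : List B) (hl : l.Nodup)
    (hs : s ∉ l) (hd : distToWall cs (cs.simple s) (cs.wordProd l) = l.length) :
    IsGrowth cs s (insert s {j | j ∈ l}) (cs.wordProd l) := by
  have key : ∀ p q : List B, p ++ q = l →
      IsGrowth cs s (insert s {j | j ∈ p}) (cs.wordProd p) := by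
    intro p
    induction p using List.reverseRecOn with
    | nil => intro q _; simpa using IsGrowth.base
    | append_singleton p a ih =>
      intro q hq
      have hq' : p ++ a :: q = l := by simpa using hq
      have hp := ih (a :: q) hq'
      have e : (insert s {j | j ∈ p ++ [a]} : Set B) = insert a (insert s {j | j ∈ p}) := by
        ext j; simp; tauto
      rw [e, cs.wordProd_append, cs.wordProd_singleton]
      refine hp.step ?_ ?_
      · rw [← hq', List.nodup_append] at hl
        rintro (rfl | h)
        · exact hs (hq' ▸ by simp)
        · exact hl.2.2 a h a (by simp) rfl
      · by_contra! hc
        have hcp : ∀ p' : List B, (∀ j ∈ p', j ∈ p) →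
            Commute (cs.simple a) (cs.wordProd p') := by
          intro p' hp'
          induction p' with
          | nil => simp
          | cons b p' ih' =>
            rw [cs.wordProd_cons]
            exact (hc b (Or.inr (hp' b (by simp)))).mul_right
              (ih' fun j hj => hp' j (List.mem_cons_of_mem _ hj))
        have h1 : IsIncident cs (cs.simple s) (cs.simple a) :=
          ⟨s, ((hc s (Or.inl rfl)).eq).symm⟩
        have h2 := distToWall_le cs (w := cs.wordProd l) h1
        have h3 : (cs.wordProd l)⁻¹ * cs.simple a = (cs.wordProd (p ++ q))⁻¹ := by
          rw [← hq', cs.wordProd_append, cs.wordProd_cons, cs.wordProd_append, ← mul_assoc,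
            ← (hcp p fun _ h => h).eq]
          simp [mul_assoc]
        rw [h3, hd, cs.length_inv] at h2
        have h4 := h2.trans (cs.length_wordProd_le _)
        rw [← hq'] at h4
        simp at h4
  exact key l [] (by simp)

theorem support_geomRep_wordProd (cs : CoxeterSystem M W) (l : List B) (i : B) (v : B →₀ ℝ)
    (hv : ∀ j, v j ≠ 0 → j = i) (j : B) (hj : geomRep cs (cs.wordProd l) v j ≠ 0) :
    j ∈ i :: l := by
  induction l generalizing j with
  | nil => simpa using hv j (by simpa using hj)
  | cons a l ih =>
    rw [cs.wordProd_cons, map_mul, LinearEquiv.mul_apply, geomRep_simple,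
      rootReflection_apply] at hj
    obtain rfl | hja := eq_or_ne j a
    · simp
    · have := ih j (by simpa [Ne.symm hja] using hj)
      simp only [List.mem_cons] at this ⊢
      tauto

/-- For a chamber `c` incident to the wall, `c⁻¹ α_s` is supported on one simple root. Each letter
of a word for `w⁻¹ c` enlarges the support by at most one element, while `w⁻¹ α_s` has support of
size `l.length + 1`. -/
theorem IsGrowth.distToWall_eq {cs : CoxeterSystem M W} {s : B} {l : List B} (hl : l.Nodup)
    (hs : s ∉ l) (h : IsGrowth cs s (insert s {j | j ∈ l}) (cs.wordProd l)) :
    distToWall cs (cs.simple s) (cs.wordProd l) = l.length := by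
  classical
  set w := cs.wordProd l with hw
  apply le_antisymm
  · refine (distToWall_le cs (isIncident_one cs s)).trans ?_
    rw [mul_one, cs.length_inv]
    exact cs.length_wordProd_le l
  · have hne : {n | ∃ c' : W, IsIncident cs (cs.simple s) c' ∧
        cs.length (w⁻¹ * c') = n}.Nonempty := ⟨_, 1, isIncident_one cs s, rfl⟩
    obtain ⟨c, ⟨i, hci⟩, hlen⟩ := Nat.sInf_mem hne
    change _ ≤ sInf _
    rw [← hlen]
    set v := geomRep cs c⁻¹ (Finsupp.single s 1) with hv
    have hneg : rootReflection M i v = -v := by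
      rw [← geomRep_simple cs, hv, ← LinearEquiv.mul_apply, ← map_mul]
      have : cs.simple i * c⁻¹ = c⁻¹ * cs.simple s := by
        rw [mul_inv_eq_iff_eq_mul, mul_assoc, hci, inv_mul_cancel_left]
      rw [this, map_mul, LinearEquiv.mul_apply, geomRep_simple, rootReflection_self, map_neg]
    have hvi : ∀ j, v j ≠ 0 → j = i := by
      intro j hj
      by_contra hji
      have := DFunLike.congr_fun hneg j
      rw [rootReflection_apply] at this
      simp [Ne.symm hji] at this
      exact hj (by linarith)
    obtain ⟨l', hl', hprod⟩ := cs.exists_isReduced (w⁻¹ * c)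
    have hroot : geomRep cs w⁻¹ (Finsupp.single s 1) = geomRep cs (cs.wordProd l') v := by
      rw [← hprod, hv, ← LinearEquiv.mul_apply, ← map_mul]
      simp
    have hsub : (s :: l).toFinset ⊆ (i :: l').toFinset := by
      intro j hj
      have hj' : j ∈ (insert s {j | j ∈ l} : Set B) := by simpa using hj
      have := h.root.1 j hj'
      rw [hroot] at this
      rw [List.mem_toFinset]
      exact support_geomRep_wordProd cs l' i v hvi j (by linarith)
    have h1 := Finset.card_le_card hsub
    rw [List.toFinset_card_of_nodup (List.nodup_cons.2 ⟨hs, hl⟩)] at h1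
    have h2 := (i :: l').toFinset_card_le
    have h3 : cs.length (w⁻¹ * c) = l'.length := by rw [hprod]; exact hl'
    simp only [List.length_cons] at h1 h2
    omega

end Growth

/-! ### Cells as cosets and their stabilisers. -/

section Cells

variable {B W : Type*} [Group W] {M : CoxeterMatrix B} (cs : CoxeterSystem M W)

/-- The cell `g W_J`. -/
def cosetCell (g : W) (J : Set B) (hJ : IsSpherical cs J) : Cell cs :=
  ⟨g • (parabolic cs J : Set W), g, J, hJ, rfl⟩

variable {cs}

theorem exists_eq_cosetCell (D : Cell cs) : ∃ g J hJ, D = cosetCell cs g J hJ := by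
  obtain ⟨D, g, J, hJ, rfl⟩ := D
  exact ⟨g, J, hJ, rfl⟩

theorem cosetCell_eq_iff {g h : W} {J : Set B} {hJ : IsSpherical cs J} :
    cosetCell cs g J hJ = cosetCell cs h J hJ ↔ g⁻¹ * h ∈ parabolic cs J :=
  Subtype.ext_iff.trans (leftCoset_eq_iff (parabolic cs J))

theorem smul_cosetCell (r g : W) (J : Set B) (hJ : IsSpherical cs J) :
    r • cosetCell cs g J hJ = cosetCell cs (r * g) J hJ :=
  Subtype.ext (smul_smul r g (parabolic cs J : Set W))

theorem smul_cosetCell_eq_iff {r g : W} {J : Set B} {hJ : IsSpherical cs J} :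
    r • cosetCell cs g J hJ = cosetCell cs g J hJ ↔ g⁻¹ * r * g ∈ parabolic cs J := by
  rw [smul_cosetCell, eq_comm, cosetCell_eq_iff, mul_assoc]

theorem cosetCell_le {g h : W} {J K : Set B} {hJ : IsSpherical cs J} {hK : IsSpherical cs K}
    (hJK : J ⊆ K) (hg : h⁻¹ * g ∈ parabolic cs K) :
    cosetCell cs g J hJ ≤ cosetCell cs h K hK := by
  rintro x ⟨y, hy, rfl⟩
  refine ⟨h⁻¹ * g * y, mul_mem hg (parabolic_mono cs hJK hy), ?_⟩
  simp [mul_assoc]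

theorem parabolic_induction_right {J : Set B} {p : W → Prop} (one : p 1)
    (mul : ∀ w ∈ parabolic cs J, ∀ j ∈ J, p w → p (w * cs.simple j)) {w : W}
    (hw : w ∈ parabolic cs J) : p w := by
  induction hw using Subgroup.closure_induction_right with
  | one => exact one
  | mul_right x hx y hy h =>
    obtain ⟨j, hj, rfl⟩ := hy
    exact mul x hx j hj h
  | mul_inv_cancel x hx y hy h =>
    obtain ⟨j, hj, rfl⟩ := hy
    rw [cs.inv_simple]
    exact mul x hx j hj h

theorem mem_parabolic_singleton {i : B} {x : W} (hx : x ∈ parabolic cs {i}) :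
    x = 1 ∨ x = cs.simple i := by
  refine parabolic_induction_right (p := fun x => x = 1 ∨ x = cs.simple i) (Or.inl rfl) ?_ hx
  rintro w - j hj h
  rw [Set.mem_singleton_iff] at hj
  subst hj
  rcases h with rfl | rfl <;> simp

theorem isSpherical_empty : IsSpherical cs ∅ := by simp [IsSpherical, parabolic]

theorem isSpherical_singleton (i : B) : IsSpherical cs {i} :=
  (Set.toFinite {1, cs.simple i}).subset fun _ hx => mem_parabolic_singleton hx

theorem isSpherical_pair_of_ne_zero {i j : B} (h : M i j ≠ 0) : IsSpherical cs {i, j} := by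
  set x := cs.simple i * cs.simple j with hx
  have hfin : IsOfFinOrder x := isOfFinOrder_iff_pow_eq_one.2
    ⟨M i j, Nat.pos_of_ne_zero h, cs.simple_mul_simple_pow i j⟩
  have hz : (Subgroup.zpowers x : Set W).Finite := finite_zpowers.2 hfin
  refine (hz.union (hz.image (· * cs.simple i))).subset fun w hw => ?_
  refine parabolic_induction_right (p := fun w => w ∈ (Subgroup.zpowers x : Set W) ∪
    (· * cs.simple i) '' (Subgroup.zpowers x : Set W)) (Or.inl (one_mem _)) ?_ hw
  rintro w - k hk ih
  have hji : cs.simple j = x⁻¹ * cs.simple i := by simp [hx]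
  have hij : cs.simple i * cs.simple j = x := rfl
  rcases hk with rfl | hk
  · rcases ih with h | ⟨y, hy, rfl⟩
    · exact Or.inr ⟨w, h, rfl⟩
    · exact Or.inl (by simpa using hy)
  · rw [Set.mem_singleton_iff] at hk
    subst hk
    rcases ih with h | ⟨y, hy, rfl⟩
    · exact Or.inr ⟨w * x⁻¹, mul_mem h (inv_mem (Subgroup.mem_zpowers x)), by
        simp only [hji, mul_assoc]⟩
    · refine Or.inl ?_
      simp only [mul_assoc, hij]
      exact mul_mem hy (Subgroup.mem_zpowers x)

/-- The edge `{c, c sᵢ}`. -/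
def edgeCell (cs : CoxeterSystem M W) (c : W) (i : B) : Cell cs :=
  cosetCell cs c {i} (isSpherical_singleton i)

theorem smul_edgeCell_of_crossed {r c : W} {i : B} (h : r * c = c * cs.simple i) :
    r • edgeCell cs c i = edgeCell cs c i := by
  rw [edgeCell, smul_cosetCell_eq_iff, mul_assoc, h, inv_mul_cancel_left]
  exact simple_mem_parabolic cs rfl

theorem edgeCell_mul_simple (c : W) (i : B) :
    edgeCell cs (c * cs.simple i) i = edgeCell cs c i := by
  rw [edgeCell, edgeCell, cosetCell_eq_iff]
  simpa using simple_mem_parabolic cs (Set.mem_singleton i)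

theorem vertexCell_eq (g : W) : vertexCell cs g = cosetCell cs g ∅ isSpherical_empty :=
  Subtype.ext (by simp [vertexCell, cosetCell, parabolic])

end Cells

/-! ### Walls as subcomplexes of the barycentric subdivision, and segments in simplices. -/

section Topology

variable {B W : Type*} [Group W] {M : CoxeterMatrix B} {cs : CoxeterSystem M W}

theorem smul_coord (g : W) (x : Point cs) (D : Cell cs) : (g • x).coord D = x.coord (g⁻¹ • D) :=
  rfl

theorem exists_coord_ne_zero (x : Point cs) : ∃ D, x.coord D ≠ 0 := by
  by_contra! h
  have := x.sum_eq_one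
  simp [h] at this

/-- The support of a fixed point is a chain preserved by `r`. Comparable translates of a finite
coset coincide, having the same cardinality. -/
theorem smul_eq_of_mem_wall {r : W} {x : Point cs} (hx : x ∈ wall cs r) {D : Cell cs}
    (hD : x.coord D ≠ 0) : r • D = D := by
  have h1 : x.coord (r⁻¹ • D) ≠ 0 := by
    rw [← smul_coord, show r • x = x from hx]
    exact hD
  have hfin : ∀ E : Cell cs, E.1.Finite := by
    rintro ⟨E, g, J, hJ, rfl⟩
    exact Set.Finite.smul_set hJ
  have hcard : (r⁻¹ • D).1.ncard = D.1.ncard := Set.ncard_smul_set r⁻¹ D.1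
  have heq : r⁻¹ • D = D := by
    rcases x.isChain_support.total h1 hD with h | h
    · exact Subtype.ext (Set.eq_of_subset_of_ncard_le h hcard.ge (hfin D))
    · exact Subtype.ext (Set.eq_of_subset_of_ncard_le h hcard.le (hfin _)).symm
  rw [← heq, smul_inv_smul, heq]

theorem mem_wall_iff {r : W} {x : Point cs} :
    x ∈ wall cs r ↔ ∀ D, x.coord D ≠ 0 → r • D = D := by
  refine ⟨fun hx D => smul_eq_of_mem_wall hx, fun h => Point.ext' (funext fun D => ?_)⟩
  rw [smul_coord]
  by_cases h1 : x.coord (r⁻¹ • D) = 0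
  · by_cases h2 : x.coord D = 0
    · rw [h1, h2]
    · rw [inv_smul_eq_iff.2 (h D h2).symm]
  · have := h _ h1
    rw [smul_inv_smul] at this
    rw [← this]

open Classical in
/-- The barycentre of the cell `D`. -/
noncomputable def cellPoint (D : Cell cs) : Point cs where
  coord := Pi.single D 1
  finite_support := (Set.finite_singleton D).subset Pi.support_single_subset
  isChain_support := (Set.subsingleton_singleton.anti Pi.support_single_subset).isChain
  nonneg E := by
    by_cases h : E = D
    · subst h; simp
    · simp [h]
  sum_eq_one := by
    rw [finsum_eq_single _ D (fun E hE => by simp [hE])]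
    simp

open Classical in
theorem support_cellPoint_subset (D : Cell cs) : (cellPoint D).coord.support ⊆ {D} :=
  Pi.support_single_subset

theorem vertex_eq_cellPoint (g : W) : vertex cs g = cellPoint (vertexCell cs g) := rfl

theorem cellPoint_mem_wall {r : W} {D : Cell cs} (h : r • D = D) : cellPoint D ∈ wall cs r :=
  mem_wall_iff.2 fun E hE => by
    rw [Set.mem_singleton_iff.1 (support_cellPoint_subset D hE)]; exact h

/-- The point dividing the segment between two points of a common closed simplex. -/
noncomputable def segmentPoint (σ : Set (Cell cs)) (hσ : IsChain (· ≤ ·) σ) (x y : Point cs)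
    (hx : x.coord.support ⊆ σ) (hy : y.coord.support ⊆ σ) (t : unitInterval) : Point cs where
  coord D := (1 - (t : ℝ)) * x.coord D + t * y.coord D
  finite_support := by
    refine (x.finite_support.union y.finite_support).subset fun D hD => ?_
    by_contra hn
    simp only [Set.mem_union, Function.mem_support, not_or, not_not] at hn
    exact hD (by simp [hn.1, hn.2])
  isChain_support := hσ.mono fun D hD => by
    by_contra hn
    have h1 : x.coord D = 0 := by_contra fun h => hn (hx h)
    have h2 : y.coord D = 0 := by_contra fun h => hn (hy h)
    exact hD (by simp [h1, h2])
  nonneg D := by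
    have h1 := x.nonneg D
    have h2 := y.nonneg D
    have h3 := t.2.1
    have h4 : 0 ≤ 1 - (t : ℝ) := sub_nonneg.2 t.2.2
    positivity
  sum_eq_one := by
    rw [finsum_add_distrib, ← mul_finsum _ _, ← mul_finsum _ _, x.sum_eq_one,
      y.sum_eq_one]
    · ring
    · exact x.finite_support.subset (Function.support_mul_subset_right _ _)
    · exact y.finite_support.subset (Function.support_mul_subset_right _ _)

theorem support_segmentPoint_subset (σ : Set (Cell cs)) (hσ : IsChain (· ≤ ·) σ) (x y : Point cs)
    (hx : x.coord.support ⊆ σ) (hy : y.coord.support ⊆ σ) (t : unitInterval) :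
    (segmentPoint σ hσ x y hx hy t).coord.support ⊆ σ := fun D hD => by
  by_contra hn
  have h1 : x.coord D = 0 := by_contra fun h => hn (hx h)
  have h2 : y.coord D = 0 := by_contra fun h => hn (hy h)
  exact hD (by simp [segmentPoint, h1, h2])

theorem continuous_segmentPoint (σ : Finset (Cell cs))
    (hσ : IsChain (· ≤ ·) (σ : Set (Cell cs))) (x y : Point cs)
    (hx : x.coord.support ⊆ (σ : Set (Cell cs))) (hy : y.coord.support ⊆ (σ : Set (Cell cs))) :
    Continuous (segmentPoint σ hσ x y hx hy) := by
  refine continuous_iSup_rng (i := ⟨σ, hσ⟩) ?_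
  let F : unitInterval → ClosedSimplex cs ⟨σ, hσ⟩ := fun t =>
    ⟨segmentPoint σ hσ x y hx hy t, support_segmentPoint_subset _ hσ x y hx hy t⟩
  let τ : TopologicalSpace (ClosedSimplex cs ⟨σ, hσ⟩) :=
    TopologicalSpace.induced (fun x : ClosedSimplex cs ⟨σ, hσ⟩ => x.1.coord) inferInstance
  have hF : Continuous F := by
    refine continuous_induced_rng.2 (continuous_pi fun D => ?_)
    change Continuous fun t : unitInterval => (1 - (t : ℝ)) * x.coord D + t * y.coord D
    fun_prop
  let G : ClosedSimplex cs ⟨σ, hσ⟩ → Point cs := fun z => z.1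
  have hG : @Continuous _ _ τ (TopologicalSpace.coinduced G τ) G := continuous_coinduced_rng
  exact @Continuous.comp _ _ _ _ τ (TopologicalSpace.coinduced G τ) F G hG hF

theorem joinedIn_of_isChain {F : Set (Point cs)} {x y : Point cs} (σ : Finset (Cell cs))
    (hσ : IsChain (· ≤ ·) (σ : Set (Cell cs))) (hx : x.coord.support ⊆ (σ : Set (Cell cs)))
    (hy : y.coord.support ⊆ (σ : Set (Cell cs)))
    (hF : ∀ z : Point cs, z.coord.support ⊆ (σ : Set (Cell cs)) → z ∈ F) : JoinedIn F x y :=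
  ⟨{ toFun := segmentPoint σ hσ x y hx hy
     continuous_toFun := continuous_segmentPoint σ hσ x y hx hy
     source' := Point.ext' (funext fun D => by simp [segmentPoint])
     target' := Point.ext' (funext fun D => by simp [segmentPoint]) },
    fun t => hF _ (support_segmentPoint_subset _ hσ x y hx hy t)⟩

theorem joinedIn_cellPoint_of_le {F : Set (Point cs)} {D E : Cell cs} (hDE : D ≤ E)
    (hF : ∀ z : Point cs, (∀ C, z.coord C ≠ 0 → C = D ∨ C = E) → z ∈ F) :
    JoinedIn F (cellPoint D) (cellPoint E) := by
  classical
  refine joinedIn_of_isChain {D, E} ?_ ?_ ?_ fun z hz => hF z fun C hC => by simpa using hz hC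
  · rw [Finset.coe_pair]
    exact IsChain.pair hDE
  · exact (support_cellPoint_subset D).trans (by simp)
  · exact (support_cellPoint_subset E).trans (by simp)

theorem joinedIn_wall_of_le {r : W} {D E : Cell cs} (hDE : D ≤ E) (hD : r • D = D)
    (hE : r • E = E) : JoinedIn (wall cs r) (cellPoint D) (cellPoint E) :=
  joinedIn_cellPoint_of_le hDE fun _ hz => mem_wall_iff.2 fun C hC => by
    rcases hz C hC with rfl | rfl <;> assumption

theorem joinedIn_wall_cellPoint {r : W} {x : Point cs} (hx : x ∈ wall cs r) {D : Cell cs}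
    (hD : x.coord D ≠ 0) : JoinedIn (wall cs r) x (cellPoint D) := by
  refine joinedIn_of_isChain x.finite_support.toFinset ?_ ?_ ?_ fun z hz => ?_
  · simpa using x.isChain_support
  · simp
  · exact (support_cellPoint_subset D).trans (by simpa using hD)
  · exact mem_wall_iff.2 fun C hC => mem_wall_iff.1 hx C (by simpa using hz hC)

end Topology

/-! ### Functions on the chambers that detect crossings of a wall. -/

section Potential

variable {B W : Type*} [Group W] {M : CoxeterMatrix B} {cs : CoxeterSystem M W}

/-- A labelling of the edges of the Cayley graph by elements of `ZMod 2` whose sums along the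
boundaries of the relations vanish is the coboundary of a function. -/
theorem exists_potential (cs : CoxeterSystem M W) (lam : W → B → ZMod 2)
    (hsymm : ∀ c i, lam (c * cs.simple i) i = lam c i)
    (hcyc : ∀ c i j, ∑ k ∈ Finset.range (M i j), (lam (c * (cs.simple i * cs.simple j) ^ k) i +
      lam (c * (cs.simple i * cs.simple j) ^ k * cs.simple i) j) = 0) :
    ∃ f : W → ZMod 2, ∀ c i, f (c * cs.simple i) = f c + lam c i := by
  -- The generators act on the double cover `W × ZMod 2` of the Cayley graph; vanishing of the
  -- cyclic sums is the Coxeter relation, and the orbit of `(1, 0)` is the graph of the potential.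
  -- Generators multiply `W` on the right, hence the evaluation at `c⁻¹`.
  have hinv (i : B) : Function.Involutive
      (fun p : W × ZMod 2 => (p.1 * cs.simple i, p.2 + lam p.1 i)) := by
    rintro ⟨c, e⟩
    simp [hsymm, add_assoc, CharTwo.add_self_eq_zero]
  let P (i : B) : Equiv.Perm (W × ZMod 2) := (hinv i).toPerm
  have hP (i : B) (c : W) (e : ZMod 2) : P i (c, e) = (c * cs.simple i, e + lam c i) := rfl
  have hlift : M.IsLiftable P := by
    intro i j
    have hpow (n : ℕ) (c : W) (e : ZMod 2) : ((P i * P j) ^ n) (c, e) =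
        (c * (cs.simple j * cs.simple i) ^ n,
          e + ∑ k ∈ Finset.range n, (lam (c * (cs.simple j * cs.simple i) ^ k) j +
            lam (c * (cs.simple j * cs.simple i) ^ k * cs.simple j) i)) := by
      induction n with
      | zero => simp
      | succ n ih =>
        rw [pow_succ', Equiv.Perm.mul_apply, ih, Equiv.Perm.mul_apply, hP, hP,
          Finset.sum_range_succ, pow_succ]
        simp only [mul_assoc, add_assoc]
    ext1 ⟨c, e⟩
    rw [hpow, M.symmetric i j, hcyc, cs.simple_mul_simple_pow]
    simp
  let φ := cs.lift ⟨P, hlift⟩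
  have hφ (i : B) : φ (cs.simple i) = P i := cs.lift_apply_simple hlift i
  have hfst (c : W) : (φ c⁻¹ (1, 0)).1 = c := by
    induction c using cs.simple_induction_right with
    | one => simp
    | mul_simple_right c i ih =>
      rw [mul_inv_rev, cs.inv_simple, map_mul, Equiv.Perm.mul_apply, hφ]
      change (φ c⁻¹ (1, 0)).1 * cs.simple i = _
      rw [ih]
  refine ⟨fun c => (φ c⁻¹ (1, 0)).2, fun c i => ?_⟩
  change (φ (c * cs.simple i)⁻¹ (1, 0)).2 = _
  rw [mul_inv_rev, cs.inv_simple, map_mul, Equiv.Perm.mul_apply, hφ]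
  change (φ c⁻¹ (1, 0)).2 + lam (φ c⁻¹ (1, 0)).1 i = _
  rw [hfst]

/-- Around a `2m`-gon opposite edges carry the same label, so everything cancels mod 2. -/
theorem sum_range_eq_zero_of_periodic {m : ℕ} (g : ℕ → ZMod 2) (h : ∀ p, g (p + m) = g p) :
    ∑ k ∈ Finset.range m, (g (2 * k) + g (2 * k + 1)) = 0 := by
  have h1 (n : ℕ) : ∑ k ∈ Finset.range n, (g (2 * k) + g (2 * k + 1)) =
      ∑ k ∈ Finset.range (2 * n), g k := by
    induction n with
    | zero => simp
    | succ n ih =>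
      rw [Finset.sum_range_succ, ih, mul_add, mul_one, Finset.sum_range_succ,
        Finset.sum_range_succ, add_assoc]
  rw [h1, two_mul, Finset.sum_range_add]
  simp only [add_comm m, h, CharTwo.add_self_eq_zero]

open Classical in
/-- If `T` is a union of connected components of the poset of cells fixed by `r`, then there is a
function on the chambers which changes its value exactly along the edges crossed by the wall of `r`
which belong to `T`. -/
theorem exists_wall_potential (r : W) (T : Cell cs → Prop)
    (hT : ∀ D E : Cell cs, D ≤ E → r • D = D → r • E = E → (T D ↔ T E)) :
    ∃ f : W → ZMod 2, ∀ c i, f (c * cs.simple i) =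
      f c + if r * c = c * cs.simple i ∧ T (edgeCell cs c i) then 1 else 0 := by
  refine exists_potential cs _ (fun c i => ?_) fun c i j => ?_
  · rw [edgeCell_mul_simple, cs.simple_mul_simple_cancel_right, ← mul_assoc]
    congr 2
    rw [eq_iff_iff]
    constructor
    · intro h; simpa using congrArg (· * cs.simple i) h
    · intro h; rw [h, cs.simple_mul_simple_cancel_right]
  obtain h0 | h0 := eq_or_ne (M i j) 0
  · simp [h0]
  set x := cs.simple i * cs.simple j with hx
  let D := cosetCell cs c {i, j} (isSpherical_pair_of_ne_zero h0)
  -- If `r` crosses an edge of the polygon `D`, it fixes both the edge and `D`, so `T` takes the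
  -- same value on them; the label then depends only on the reflection of the edge.
  have hlam (v : W) (hv : v ∈ parabolic cs {i, j}) (k : B) (hk : k ∈ ({i, j} : Set B)) :
      (if r * (c * v) = c * v * cs.simple k ∧ T (edgeCell cs (c * v) k) then (1 : ZMod 2) else 0) =
        if r = c * (v * cs.simple k * v⁻¹) * c⁻¹ ∧ T D then 1 else 0 := by
    have h1 : r * (c * v) = c * v * cs.simple k ↔ r = c * (v * cs.simple k * v⁻¹) * c⁻¹ := by
      rw [eq_mul_inv_iff_mul_eq, ← mul_assoc c, eq_mul_inv_iff_mul_eq]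
      simp only [mul_assoc]
    rw [← h1]
    congr 1
    rw [eq_iff_iff]
    refine and_congr_right fun hc => hT _ _ ?_ (smul_edgeCell_of_crossed hc) ?_
    · exact cosetCell_le (Set.singleton_subset_iff.2 hk) (by simpa using hv)
    · rw [smul_cosetCell_eq_iff]
      have : c⁻¹ * r * c = v * cs.simple k * v⁻¹ := by
        rw [h1.1 hc]; group
      rw [this]
      exact mul_mem (mul_mem hv (simple_mem_parabolic cs hk)) (inv_mem hv)
  have hi : cs.simple i ∈ parabolic cs {i, j} := simple_mem_parabolic cs (by simp)
  have hj : cs.simple j ∈ parabolic cs {i, j} := simple_mem_parabolic cs (by simp)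
  have hxm : x ∈ parabolic cs {i, j} := mul_mem hi hj
  have hxi (n : ℕ) : cs.simple i * (x ^ n)⁻¹ = x ^ n * cs.simple i := by
    have : SemiconjBy (cs.simple i) x⁻¹ x := by
      simp [SemiconjBy, hx, mul_assoc]
    simpa using (this.pow_right n).eq
  let g : ℕ → ZMod 2 := fun p => if r = c * (x ^ p * cs.simple i) * c⁻¹ ∧ T D then 1 else 0
  have hg : ∀ p, g (p + M i j) = g p := fun p => by
    simp only [g]
    rw [pow_add, hx, cs.simple_mul_simple_pow, mul_one]
  refine (Finset.sum_congr rfl fun k _ => ?_).trans (sum_range_eq_zero_of_periodic g hg)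
  have e1 : x ^ k * cs.simple i * (x ^ k)⁻¹ = x ^ (2 * k) * cs.simple i := by
    rw [mul_assoc, hxi, ← mul_assoc, ← pow_add, two_mul]
  have e2 : x ^ k * cs.simple i * cs.simple j * (x ^ k * cs.simple i)⁻¹ =
      x ^ (2 * k + 1) * cs.simple i := by
    rw [mul_inv_rev, cs.inv_simple, mul_assoc (x ^ k), ← hx, ← mul_assoc, mul_assoc (x ^ k * x),
      hxi, ← pow_succ, ← mul_assoc, ← pow_add]
    congr 2
    omega
  have h1 := hlam _ (pow_mem hxm k) i (by simp)
  have h2 := hlam _ (mul_mem (pow_mem hxm k) hi) j (by simp)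
  rw [e1] at h1
  rw [e2, ← mul_assoc c (x ^ k) (cs.simple i)] at h2
  exact congrArg₂ (· + ·) h1 h2

end Potential

/-! ### Connectedness of walls and the description of bases by growths. -/

section Walls

variable {B W : Type*} [Group W] {M : CoxeterMatrix B} {cs : CoxeterSystem M W}

open Classical in
/-- The potential of a wall changes by a constant under the reflection. -/
theorem potential_reflection {r : W} {T : Cell cs → Prop} {f : W → ZMod 2}
    (hf : ∀ c i, f (c * cs.simple i) =
      f c + if r * c = c * cs.simple i ∧ T (edgeCell cs c i) then 1 else 0) (c : W) :
    f (r * c) + f c = f r + f 1 := by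
  induction c using cs.simple_induction_right with
  | one => simp
  | mul_simple_right c i ih =>
    rw [← mul_assoc, hf, hf, ← ih]
    have h : r * (r * c) = r * c * cs.simple i ∧ T (edgeCell cs (r * c) i) ↔
        r * c = c * cs.simple i ∧ T (edgeCell cs c i) := by
      have h1 : r * (r * c) = r * c * cs.simple i ↔ r * c = c * cs.simple i := by
        rw [mul_assoc r c, mul_right_inj]
      rw [h1]
      refine and_congr_right fun h => ?_
      rw [h, edgeCell_mul_simple]
    simp only [h]
    generalize (if r * c = c * cs.simple i ∧ T (edgeCell cs c i) then (1 : ZMod 2) else 0) = x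
    calc f (r * c) + x + (f c + x) = f (r * c) + f c + (x + x) := by ring
      _ = f (r * c) + f c := by rw [CharTwo.add_self_eq_zero, add_zero]

/-- The endpoints of a crossed edge are swapped by `r`, so the jump of the potential there is the
constant `f r + f 1`, the same for all crossed edges. -/
theorem crossed_iff_crossed {r : W} {T : Cell cs → Prop}
    (hT : ∀ D E : Cell cs, D ≤ E → r • D = D → r • E = E → (T D ↔ T E)) {c c' : W} {i i' : B}
    (h : r * c = c * cs.simple i) (h' : r * c' = c' * cs.simple i') :
    T (edgeCell cs c i) ↔ T (edgeCell cs c' i') := by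
  classical
  obtain ⟨f, hf⟩ := exists_wall_potential r T hT
  have key (c : W) (i : B) (h : r * c = c * cs.simple i) :
      (if T (edgeCell cs c i) then (1 : ZMod 2) else 0) = f r + f 1 := by
    rw [← potential_reflection hf c, h, hf]
    simp only [h, true_and]
    rw [add_right_comm, CharTwo.add_self_eq_zero, zero_add]
  have := (key c i h).trans (key c' i' h').symm
  by_cases h1 : T (edgeCell cs c i) <;> by_cases h2 : T (edgeCell cs c' i') <;> simp_all

/-- A cell fixed by a reflection contains an edge crossed by its wall. -/
theorem exists_crossed_edge_le {r : W} (hr : cs.IsReflection r) {D : Cell cs} (hD : r • D = D) :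
    ∃ c i, r * c = c * cs.simple i ∧ edgeCell cs c i ≤ D := by
  classical
  obtain ⟨g, J, hJ, rfl⟩ := exists_eq_cosetCell D
  rw [smul_cosetCell_eq_iff] at hD
  by_contra! hn
  -- Without a crossed edge in `D` this potential would be constant on `D`; but `r` preserves `D`
  -- and changes the potential by 1 everywhere.
  obtain ⟨f, hf⟩ := exists_wall_potential (cs := cs) r (fun _ => True) (by simp)
  have hconst : ∀ v ∈ parabolic cs J, f (g * v) = f g := fun v hv => by
    refine parabolic_induction_right (p := fun v => f (g * v) = f g) (by simp) ?_ hv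
    intro w hw j hj ih
    rw [← mul_assoc, hf, ih, if_neg, add_zero]
    rintro ⟨h, -⟩
    exact hn _ _ h (cosetCell_le (Set.singleton_subset_iff.2 hj) (by simpa using hw))
  have h1 := hconst _ hD
  obtain ⟨c, i, rfl⟩ := hr
  have h2 := potential_reflection (T := fun _ => True) hf c
  have h3 := potential_reflection (T := fun _ => True) hf g
  have e1 : g * (g⁻¹ * (c * cs.simple i * c⁻¹) * g) = c * cs.simple i * c⁻¹ * g := by group
  have e2 : c * cs.simple i * c⁻¹ * c = c * cs.simple i := by group
  rw [e1] at h1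
  rw [h1, CharTwo.add_self_eq_zero] at h3
  rw [← h3, e2, hf, e2, if_pos ⟨rfl, trivial⟩, add_right_comm, CharTwo.add_self_eq_zero] at h2
  simp at h2

/-- Every point of the wall is joined to a fixed cell, and that to a crossed edge in it. Applying
`crossed_iff_crossed` to the path component of one crossed edge shows that it contains all of them.
-/
theorem isPathConnected_wall {r : W} (hr : cs.IsReflection r) : IsPathConnected (wall cs r) := by
  obtain ⟨c, i, rfl⟩ := id hr
  set r := c * cs.simple i * c⁻¹ with hrdef
  have hc : r * c = c * cs.simple i := by simp [hrdef]
  refine ⟨cellPoint (edgeCell cs c i), cellPoint_mem_wall (smul_edgeCell_of_crossed hc),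
    fun {y} hy => ?_⟩
  obtain ⟨D, hD⟩ := exists_coord_ne_zero y
  have hrD := smul_eq_of_mem_wall hy hD
  obtain ⟨c', i', hc', hle⟩ := exists_crossed_edge_le hr hrD
  let T : Cell cs → Prop := fun E => JoinedIn (wall cs r) (cellPoint (edgeCell cs c i)) (cellPoint E)
  have hT : T (edgeCell cs c' i') := by
    refine (crossed_iff_crossed (T := T) (fun D E hDE hD hE => ?_) hc hc').1
      (JoinedIn.refl (cellPoint_mem_wall (smul_edgeCell_of_crossed hc)))
    have := joinedIn_wall_of_le hDE hD hE
    exact ⟨fun h => h.trans this, fun h => h.trans this.symm⟩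
  exact (hT.trans (joinedIn_wall_of_le hle (smul_edgeCell_of_crossed hc') hrD)).trans
    (joinedIn_wall_cellPoint hy hD).symm

theorem smul_wall (w r : W) : w • wall cs r = wall cs (w * r * w⁻¹) := by
  ext x
  rw [Set.mem_smul_set_iff_inv_smul_mem]
  simp only [wall, Set.mem_ofPred_eq, mul_smul]
  rw [← inv_smul_eq_iff (g := w⁻¹), inv_inv]

theorem isOfFinOrder_of_mem_wall_inter {r t : W} {x : Point cs} (hr : x ∈ wall cs r)
    (ht : x ∈ wall cs t) : IsOfFinOrder (r * t) := by
  obtain ⟨D, hD⟩ := exists_coord_ne_zero x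
  have h : (r * t) • D = D := by
    rw [mul_smul, smul_eq_of_mem_wall ht hD, smul_eq_of_mem_wall hr hD]
  obtain ⟨g, J, hJ, rfl⟩ := exists_eq_cosetCell D
  have h1 := hJ.isOfFinOrder (smul_cosetCell_eq_iff.1 h)
  have h2 := (MulAut.conj g).toMonoidHom.isOfFinOrder h1
  have e : (MulAut.conj g).toMonoidHom (g⁻¹ * (r * t) * g) = r * t := by
    simp [mul_assoc]
  rwa [e] at h2

/-- A gallery from `1` to `w` inside `W_J` passes only through vertices and edges whose stabilisers
lie in `W_J`. If `r ∉ W_J`, it avoids the wall. -/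
theorem mem_parabolic_of_wallSeparates {J : Set B} {r w : W} (hw : w ∈ parabolic cs J)
    (h : WallSeparates cs r w 1) : r ∈ parabolic cs J := by
  by_contra hr
  have hnot (c : W) (hc : c ∈ parabolic cs J) (K : Set B) (hK : IsSpherical cs K) (hKJ : K ⊆ J) :
      r • cosetCell cs c K hK ≠ cosetCell cs c K hK := fun h => hr <| by
    rw [smul_cosetCell_eq_iff] at h
    have h1 := mul_mem (mul_mem hc (parabolic_mono cs hKJ h)) (inv_mem hc)
    have e : c * (c⁻¹ * r * c) * c⁻¹ = r := by group
    rwa [e] at h1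
  have hvert (c : W) (hc : c ∈ parabolic cs J) : r • vertexCell cs c ≠ vertexCell cs c := by
    rw [vertexCell_eq]
    exact hnot c hc ∅ _ (Set.empty_subset J)
  have hmem (c : W) (hc : c ∈ parabolic cs J) : vertex cs c ∈ (wall cs r)ᶜ := fun h => by
    obtain ⟨D, hD⟩ := exists_coord_ne_zero (vertex cs c)
    have h1 := support_cellPoint_subset (vertexCell cs c) hD
    rw [Set.mem_singleton_iff] at h1
    subst h1
    exact hvert c hc (smul_eq_of_mem_wall h hD)
  have hedge (c : W) (hc : c ∈ parabolic cs J) (j : B) (hj : j ∈ J) :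
      JoinedIn (wall cs r)ᶜ (vertex cs c) (cellPoint (edgeCell cs c j)) := by
    rw [vertex_eq_cellPoint]
    refine joinedIn_cellPoint_of_le ?_ fun z hz hzr => ?_
    · rw [vertexCell_eq]
      exact cosetCell_le (Set.empty_subset _) (by simp)
    · obtain ⟨D, hD⟩ := exists_coord_ne_zero z
      rcases hz D hD with rfl | rfl
      · exact hvert c hc (smul_eq_of_mem_wall hzr hD)
      · exact hnot c hc {j} _ (Set.singleton_subset_iff.2 hj) (smul_eq_of_mem_wall hzr hD)
  have hjoin : JoinedIn (wall cs r)ᶜ (vertex cs 1) (vertex cs w) := by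
    refine parabolic_induction_right (p := fun w => JoinedIn (wall cs r)ᶜ (vertex cs 1)
      (vertex cs w)) (JoinedIn.refl (hmem 1 (one_mem _))) ?_ hw
    intro v hv j hj ih
    have h1 := hedge v hv j hj
    have h2 := hedge _ (mul_mem hv (simple_mem_parabolic cs hj)) j hj
    rw [edgeCell_mul_simple] at h2
    exact ih.trans (h1.trans h2.symm)
  have h1 := hmem 1 (one_mem _)
  refine h ⟨_, ⟨vertex cs 1, h1, rfl⟩, ?_, mem_connectedComponentIn h1⟩
  exact (isPathConnected_pathComponentIn h1).isConnected.isPreconnected.subset_connectedComponentIn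
    (mem_pathComponentIn_self h1) pathComponentIn_subset hjoin

/-- The intersection condition on separating walls is automatic: their reflections lie in the finite
group `W_J`, which fixes the barycentre of its own cell. -/
theorem isBase_iff {s : B} {w : W} {J : Set B} :
    IsBase cs s w J ↔ IsGrowth cs s J w ∧ IsSpherical cs J := by
  constructor
  · rintro ⟨l, hl, hs, rfl, hd, -, rfl, hJ⟩
    exact ⟨isGrowth_of_distToWall cs s l hl hs hd, hJ⟩
  · rintro ⟨h, hJ⟩
    obtain ⟨l, hl, hs, rfl, rfl⟩ := h.exists_list
    refine ⟨l, hl, hs, rfl, h.distToWall_eq hl hs, fun r _ hsep => ?_, rfl, hJ⟩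
    refine ⟨cellPoint (cosetCell cs 1 _ hJ), cellPoint_mem_wall ?_, cellPoint_mem_wall ?_⟩
    · rw [smul_cosetCell_eq_iff]
      simpa using mem_parabolic_of_wallSeparates h.elt_mem hsep
    · rw [smul_cosetCell_eq_iff]
      simpa using simple_mem_parabolic cs h.mem

end Walls

/-! ### Half-spaces of markings and their invariance under moves. -/

section HalfSpaces

variable {B B' W : Type*} [Group W] {M : CoxeterMatrix B} {M' : CoxeterMatrix B'}
  {cs : CoxeterSystem M W} {cs' : CoxeterSystem M' W}

theorem IsAngleCompatible.isReflection (h : IsAngleCompatible cs cs') (s : B) :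
    cs'.IsReflection (cs.simple s) := by
  obtain ⟨g, s', t', hg⟩ := h s s (by simpa using isSpherical_singleton s)
  have h1 : cs'.simple s' ∈ (fun x => g * x * g⁻¹) '' ({cs.simple s, cs.simple s} : Set W) := by
    rw [hg]; simp
  obtain ⟨x, hx, hx'⟩ := h1
  have : x = cs.simple s := by simpa using hx
  subst this
  refine ⟨g⁻¹, s', ?_⟩
  rw [← hx']
  group

/-- By angle-compatibility `⟨s, t⟩` is the stabiliser of the cell `g⁻¹ W'_{s',t'}`, so it fixes the
barycentre of that cell. -/
theorem IsAngleCompatible.nonempty_wall_inter (h : IsAngleCompatible cs cs') {s t : B}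
    (hst : IsSpherical cs {s, t}) :
    (wall cs' (cs.simple s) ∩ wall cs' (cs.simple t)).Nonempty := by
  obtain ⟨g, s', t', hg⟩ := h s t hst
  have hpar : parabolic cs' {s', t'} = (parabolic cs {s, t}).map (MulAut.conj g).toMonoidHom := by
    rw [parabolic, parabolic, MonoidHom.map_closure, Set.image_pair, Set.image_pair, ← hg]
    rfl
  have hsph : IsSpherical cs' {s', t'} := by
    rw [IsSpherical, hpar, Subgroup.coe_map]
    exact Set.Finite.image _ hst
  have key (a : B) (ha : a ∈ ({s, t} : Set B)) :
      cellPoint (cosetCell cs' g⁻¹ {s', t'} hsph) ∈ wall cs' (cs.simple a) := by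
    apply cellPoint_mem_wall
    rw [smul_cosetCell_eq_iff, hpar, inv_inv]
    exact ⟨_, simple_mem_parabolic cs ha, rfl⟩
  exact ⟨_, key s (by simp), key t (by simp)⟩

theorem Marking.exists_eq_zero (hFC : IsTypeFC cs) (μ : Marking cs) :
    ∃ j ∈ μ.support, M μ.marker j = 0 := by
  obtain ⟨j, hj, h⟩ := μ.marker_spec
  refine ⟨j, hj, ?_⟩
  rwa [isSpherical_pair_iff hFC, not_not] at h

theorem Marking.isGrowth (μ : Marking cs) : IsGrowth cs μ.core μ.support μ.elt :=
  (isBase_iff.1 μ.isBase).1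

theorem Marking.isSpherical (μ : Marking cs) : IsSpherical cs μ.support :=
  (isBase_iff.1 μ.isBase).2

theorem Marking.marker_notMem (μ : Marking cs) : μ.marker ∉ μ.support := fun h => by
  obtain ⟨j, hj, hn⟩ := μ.marker_spec
  exact hn (μ.isSpherical.mono (Set.pair_subset h hj))

theorem Marking.elt_eq {μ ν : Marking cs} (hcore : μ.core = ν.core)
    (hsupp : μ.support = ν.support) : μ.elt = ν.elt := by
  have h1 := μ.isGrowth
  rw [hcore, hsupp] at h1
  exact h1.unique ν.isGrowth ν.isSpherical

theorem Marking.ext_of_support_marker {μ ν : Marking cs} (hcore : μ.core = ν.core)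
    (hsupp : μ.support = ν.support) (hm : μ.marker = ν.marker) : μ = ν := by
  have h := Marking.elt_eq hcore hsupp
  cases μ; cases ν
  cases hcore; cases hsupp; cases hm; cases h
  rfl

/-- The wall of the core is disjoint from the translate of the wall of the marker. -/
theorem Marking.smul_wall_subset (hFC : IsTypeFC cs) (μ : Marking cs) :
    μ.elt • wall cs' (cs.simple μ.marker) ⊆ (wall cs' (cs.simple μ.core))ᶜ := by
  intro x hx hx'
  rw [smul_wall] at hx
  obtain ⟨j, hj, h0⟩ := μ.exists_eq_zero hFC
  refine μ.isGrowth.not_isOfFinOrder μ.marker_notMem {j} (by simpa using hj)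
    (by rw [Finset.sum_singleton, M.symmetric, h0]; simp) ?_
  have h1 := (MulAut.conj μ.elt⁻¹).toMonoidHom.isOfFinOrder
    (isOfFinOrder_of_mem_wall_inter hx' hx)
  convert h1 using 1
  simp [mul_assoc]

/-- The translated wall is connected and misses the wall of the core, so it lies in the component of
any of its points and in no other. -/
theorem Marking.isMarkingHalfSpace_iff (hFC : IsTypeFC cs) (hangle : IsAngleCompatible cs cs')
    (μ : Marking cs) {x : Point cs'} (hx : x ∈ μ.elt • wall cs' (cs.simple μ.marker))
    (Ψ : Set (Point cs')) : IsMarkingHalfSpace cs' μ Ψ ↔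
      Ψ = connectedComponentIn (wall cs' (cs.simple μ.core))ᶜ x := by
  have hsub := μ.smul_wall_subset (cs' := cs') hFC
  constructor
  · rintro ⟨⟨y, hy, rfl⟩, h⟩
    exact connectedComponentIn_eq (h hx)
  · rintro rfl
    refine ⟨⟨x, hsub hx, rfl⟩, IsPreconnected.subset_connectedComponentIn ?_ hx hsub⟩
    rw [smul_wall]
    exact (isPathConnected_wall ((hangle.isReflection _).conj μ.elt)).isConnected.isPreconnected

theorem Marking.wall_nonempty (hangle : IsAngleCompatible cs cs') (μ : Marking cs) :
    (μ.elt • wall cs' (cs.simple μ.marker)).Nonempty := by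
  rw [smul_wall]
  exact (isPathConnected_wall ((hangle.isReflection _).conj μ.elt)).nonempty

theorem isMarkingHalfSpace_congr (hFC : IsTypeFC cs) (hangle : IsAngleCompatible cs cs')
    {μ ν : Marking cs} (hcore : μ.core = ν.core)
    (h : (μ.elt • wall cs' (cs.simple μ.marker) ∩
      ν.elt • wall cs' (cs.simple ν.marker)).Nonempty) (Ψ : Set (Point cs')) :
    IsMarkingHalfSpace cs' μ Ψ ↔ IsMarkingHalfSpace cs' ν Ψ := by
  obtain ⟨x, hx, hx'⟩ := h
  rw [μ.isMarkingHalfSpace_iff hFC hangle hx, ν.isMarkingHalfSpace_iff hFC hangle hx', hcore]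

theorem MoveOne.isMarkingHalfSpace_iff (hFC : IsTypeFC cs) (hangle : IsAngleCompatible cs cs')
    {μ ν : Marking cs} (h : MoveOne μ ν) (Ψ : Set (Point cs')) :
    IsMarkingHalfSpace cs' μ Ψ ↔ IsMarkingHalfSpace cs' ν Ψ := by
  obtain ⟨hcore, hsupp, -, hadj⟩ := h
  refine isMarkingHalfSpace_congr hFC hangle hcore ?_ Ψ
  rw [Marking.elt_eq hcore hsupp, ← Set.smul_set_inter]
  exact (hangle.nonempty_wall_inter hadj).smul_set

theorem MoveTwo.isMarkingHalfSpace_iff (hFC : IsTypeFC cs) (hangle : IsAngleCompatible cs cs')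
    {μ ν : Marking cs} (h : MoveTwo μ ν) (Ψ : Set (Point cs')) :
    IsMarkingHalfSpace cs' μ Ψ ↔ IsMarkingHalfSpace cs' ν Ψ := by
  obtain ⟨hcore, hmark, j, hsupp, -, hadj⟩ := h
  by_cases hj : j ∈ ν.support
  · rw [Set.union_eq_self_of_subset_right (Set.singleton_subset_iff.2 hj)] at hsupp
    rw [Marking.ext_of_support_marker hcore hsupp hmark]
  refine isMarkingHalfSpace_congr hFC hangle hcore ?_ Ψ
  -- Irreducibility of the larger support makes adding `j` a growth step, so uniqueness gives `μ.elt
  -- = ν.elt * s_j`. A common point `p` of the walls of `m` and `j` is then moved by both elements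
  -- to the same point.
  have hnc : ∃ b ∈ ν.support, ¬ Commute (cs.simple j) (cs.simple b) := by
    by_contra! hc
    refine μ.isGrowth.isIrreducible ⟨ν.support, ⟨_, ν.isGrowth.mem⟩, ?_, ?_⟩
    · rw [hsupp]
      exact ⟨Set.subset_union_left, fun h => hj (h (Or.inr rfl))⟩
    · rw [hsupp]
      exact Set.union_subset_union_right _ (Set.singleton_subset_iff.2 ⟨hj, hc⟩)
  have helt : μ.elt = ν.elt * cs.simple j := by
    have h1 := μ.isGrowth
    have h2 := ν.isGrowth.step hj hnc
    rw [hsupp, Set.union_singleton, hcore] at h1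
    refine h1.unique h2 ?_
    rw [← Set.union_singleton, ← hsupp]
    exact μ.isSpherical
  obtain ⟨p, hpm, hpj⟩ := hangle.nonempty_wall_inter hadj
  refine ⟨ν.elt • p, ?_, ?_⟩
  · rw [helt]
    refine ⟨p, hpm, ?_⟩
    change (ν.elt * cs.simple j) • p = ν.elt • p
    rw [mul_smul, show cs.simple j • p = p from hpj]
  · rw [← hmark]
    exact ⟨p, hpm, rfl⟩

theorem MoveEquiv.isMarkingHalfSpace_iff (hFC : IsTypeFC cs) (hangle : IsAngleCompatible cs cs')
    {μ ν : Marking cs} (h : MoveEquiv μ ν) (Ψ : Set (Point cs')) :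
    IsMarkingHalfSpace cs' μ Ψ ↔ IsMarkingHalfSpace cs' ν Ψ := by
  induction h with
  | rel μ ν h =>
    rcases h with h | h
    · exact h.isMarkingHalfSpace_iff hFC hangle Ψ
    · exact h.isMarkingHalfSpace_iff hFC hangle Ψ
  | refl => rfl
  | symm _ _ _ ih => exact ih.symm
  | trans _ _ _ _ _ ih1 ih2 => exact ih1.trans ih2

end HalfSpaces

/-! ### Connecting markings by moves. -/

section Moves

variable {B W : Type*} [Group W] {M : CoxeterMatrix B} {cs : CoxeterSystem M W}

theorem definingGraph_adj_iff (hFC : IsTypeFC cs) {a b : B} :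
    (definingGraph cs).Adj a b ↔ a ≠ b ∧ M a b ≠ 0 := by
  rw [← isSpherical_pair_iff hFC]
  rfl

theorem isSpherical_insert (hFC : IsTypeFC cs) {J : Set B} (hJ : IsSpherical cs J) {x : B}
    (hx : ∀ j ∈ J, M x j ≠ 0) : IsSpherical cs (insert x J) := by
  rw [isSpherical_iff hFC] at hJ ⊢
  rintro a (rfl | ha) b (rfl | hb)
  · simp
  · exact hx b hb
  · rw [M.symmetric]; exact hx a ha
  · exact hJ a ha b hb

theorem IsIrreducible.insert {J : Set B} (hJ : IsIrreducible cs J) (hne : J.Nonempty)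
    (hsph : IsSpherical cs J) {x : B} (hx : x ∈ (J ∪ perp cs J)ᶜ) :
    IsIrreducible cs (insert x J) := by
  obtain ⟨s, hs⟩ := hne
  obtain ⟨w, hw⟩ := exists_isGrowth hs hsph.finite hJ
  rw [Set.mem_compl_iff, Set.mem_union, not_or] at hx
  refine (hw.step hx.1 ?_).isIrreducible
  by_contra! hc
  exact hx.2 ⟨hx.1, hc⟩

theorem exists_notMem_union_perp (hirr : IsIrreducible cs Set.univ)
    (hnonsph : ¬ IsSpherical cs Set.univ) {J : Set B} (hne : J.Nonempty)
    (hsph : IsSpherical cs J) : ((J ∪ perp cs J)ᶜ).Nonempty := by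
  by_contra hn
  rw [Set.not_nonempty_iff_eq_empty, Set.compl_empty_iff] at hn
  refine hirr ⟨J, hne, ?_, hn.ge⟩
  rw [Set.ssubset_univ_iff]
  rintro rfl
  exact hnonsph hsph

theorem exists_marking {s : B} {J : Set B} (hs : s ∈ J) (hirr : IsIrreducible cs J)
    (hsph : IsSpherical cs J) {m : B} (hm : ∃ j ∈ J, ¬ IsSpherical cs {m, j}) :
    ∃ μ : Marking cs, μ.core = s ∧ μ.support = J ∧ μ.marker = m := by
  obtain ⟨w, hw⟩ := exists_isGrowth hs hsph.finite hirr
  exact ⟨⟨s, w, J, isBase_iff.2 ⟨hw, hsph⟩, m, hm⟩, rfl, rfl, rfl⟩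

theorem Marking.marker_mem_compl (hFC : IsTypeFC cs) (μ : Marking cs) :
    μ.marker ∈ (μ.support ∪ perp cs μ.support)ᶜ := by
  rintro (h | h)
  · exact μ.marker_notMem h
  · obtain ⟨j, hj, h0⟩ := μ.exists_eq_zero hFC
    exact not_commute_of_eq_zero cs h0 (h.2 j hj)

/-- The union of an ascending chain has only finite exponents, so by type FC it is spherical and
hence finite, and the chain stabilises. This allows an infinite generating set. -/
theorem wellFoundedGT_spherical (hFC : IsTypeFC cs) :
    WellFoundedGT {J : Set B // IsSpherical cs J} := by
  rw [wellFoundedGT_iff_monotone_chain_condition]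
  intro a
  have hU : IsSpherical cs (⋃ n, (a n).1) := by
    rw [isSpherical_iff hFC]
    intro x hx y hy
    rw [Set.mem_iUnion] at hx hy
    obtain ⟨n, hn⟩ := hx
    obtain ⟨k, hk⟩ := hy
    exact ne_zero_of_isSpherical (a (max n k)).2 (a.monotone (le_max_left n k) hn)
      (a.monotone (le_max_right n k) hk)
  have hdir : Directed (· ⊆ ·) fun n => (a n).1 := directed_of_isDirected_le a.monotone
  obtain ⟨n, hn⟩ := hdir.exists_mem_subset_of_finset_subset_biUnion
    (s := hU.finite.toFinset) (by simp)
  rw [Set.Finite.coe_toFinset] at hn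
  refine ⟨n, fun m hm => le_antisymm (a.monotone hm) ?_⟩
  exact (Set.subset_iUnion (fun n => (a n).1) m).trans hn

/-- Every irreducible spherical subset is contained in the support of a marking. -/
theorem exists_marking_support_supset (hirr : IsIrreducible cs Set.univ)
    (hnonsph : ¬ IsSpherical cs Set.univ) (hFC : IsTypeFC cs) {s : B} {J : Set B} (hs : s ∈ J)
    (hJirr : IsIrreducible cs J) (hJ : IsSpherical cs J) :
    ∃ μ : Marking cs, μ.core = s ∧ J ⊆ μ.support := by
  have hwf := wellFoundedGT_spherical hFC
  obtain ⟨K, ⟨hJK, hKirr⟩, hmax⟩ := hwf.wf.has_min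
    {K : {J : Set B // IsSpherical cs J} | J ⊆ K.1 ∧ IsIrreducible cs K.1}
    ⟨⟨J, hJ⟩, subset_rfl, hJirr⟩
  have hKne : K.1.Nonempty := ⟨s, hJK hs⟩
  -- By maximality of `K`, the set `K ∪ {y}`, which is irreducible, is not spherical; so `y` can
  -- serve as a marker.
  obtain ⟨y, hy⟩ := exists_notMem_union_perp hirr hnonsph hKne K.2
  have hns : ∃ j ∈ K.1, ¬ IsSpherical cs {y, j} := by
    by_contra! hc
    have hsph : IsSpherical cs (insert y K.1) :=
      isSpherical_insert hFC K.2 fun j hj => (isSpherical_pair_iff hFC).1 (hc j hj)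
    refine hmax ⟨_, hsph⟩ ⟨hJK.trans (Set.subset_insert _ _), hKirr.insert hKne K.2 hy⟩ ?_
    exact Set.ssubset_insert fun h => hy (Or.inl h)
  obtain ⟨μ, h1, h2, -⟩ := exists_marking (hJK hs) hKirr K.2 hns
  exact ⟨μ, h1, h2 ▸ hJK⟩

theorem reachable_of_not_weaklySeparates {J : Set B} (hirr : IsIrreducible cs J)
    (hsph : IsSpherical cs J) (h : ¬ WeaklySeparates cs J)
    (a b : ((J ∪ perp cs J)ᶜ : Set B)) :
    ((definingGraph cs).induce ((J ∪ perp cs J)ᶜ)).Reachable a b := by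
  by_contra hab
  set G := (definingGraph cs).induce ((J ∪ perp cs J)ᶜ)
  refine h ⟨hirr, hsph, Subtype.val '' {x | G.Reachable a x}, Subtype.val '' {x | ¬ G.Reachable a x},
    ⟨a, a, SimpleGraph.Reachable.refl _, rfl⟩, ⟨b, b, hab, rfl⟩, ?_, ?_, ?_⟩
  · rw [Set.disjoint_image_iff Subtype.val_injective, Set.disjoint_left]
    exact fun x h1 h2 => h2 h1
  · rw [← Set.image_union]
    ext x
    constructor
    · rintro ⟨y, -, rfl⟩; exact y.2
    · intro hx; exact ⟨⟨x, hx⟩, em _, rfl⟩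
  · rintro _ ⟨x, hx, rfl⟩ _ ⟨y, hy, rfl⟩ hadj
    exact hy (SimpleGraph.Reachable.trans hx
      (SimpleGraph.Adj.reachable (show G.Adj x y from hadj)))

theorem Marking.relSet_nonempty (μ : Marking cs) {I : Set B} (hne : I.Nonempty)
    (hI : I ⊆ μ.support) : (μ.relSet I).Nonempty := by
  obtain h | h := eq_or_ne μ.support I
  · exact ⟨μ.marker, Or.inr ⟨h, rfl⟩⟩
  have hss : I ⊂ μ.support := hI.ssubset_of_ne h.symm
  by_contra hn
  refine μ.isGrowth.isIrreducible ⟨I, hne, hss, fun j hj => ?_⟩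
  by_contra hj'
  exact hn ⟨j, Or.inl ⟨hss, hj, hj'⟩⟩

theorem Marking.relSet_subset_compl (hFC : IsTypeFC cs) (μ : Marking cs) (I : Set B) :
    μ.relSet I ⊆ (I ∪ perp cs I)ᶜ := by
  rintro k (⟨-, h⟩ | ⟨rfl, rfl⟩)
  · exact h.2
  · exact μ.marker_mem_compl hFC

/-- The marking `μ`, whose support contains `I`, is directed towards the element `x` of the
complement of `I ∪ I^⊥`. -/
def Marking.PointsTo (μ : Marking cs) (I : Set B) (x : B) : Prop :=
  (μ.support = I ∧ μ.marker = x) ∨ insert x I ⊆ μ.support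

theorem Marking.pointsTo_of_mem_relSet {μ : Marking cs} {I : Set B} {x : B}
    (h : x ∈ μ.relSet I) : μ.PointsTo I x := by
  rcases h with ⟨h1, h2⟩ | ⟨h1, h2⟩
  · exact Or.inr (Set.insert_subset h2.1 h1.1)
  · exact Or.inl ⟨h1, h2.symm⟩

theorem MoveEquiv.symm {μ ν : Marking cs} (h : MoveEquiv μ ν) : MoveEquiv ν μ :=
  Relation.EqvGen.symm _ _ h

theorem MoveEquiv.trans {μ ν ρ : Marking cs} (h : MoveEquiv μ ν) (h' : MoveEquiv ν ρ) :
    MoveEquiv μ ρ :=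
  Relation.EqvGen.trans _ _ _ h h'

theorem MoveOne.moveEquiv {μ ν : Marking cs} (h : MoveOne μ ν) : MoveEquiv μ ν :=
  Relation.EqvGen.rel _ _ (Or.inl h)

theorem MoveTwo.moveEquiv {μ ν : Marking cs} (h : MoveTwo μ ν) : MoveEquiv μ ν :=
  Relation.EqvGen.rel _ _ (Or.inr h)

/-- The hypothesis `hsup` is the inductive assumption for the sets `I ∪ {x}`; what remains is to
pass from one vertex of a path to the next. -/
theorem moveEquiv_of_reachable (hirr : IsIrreducible cs Set.univ)
    (hnonsph : ¬ IsSpherical cs Set.univ) (hFC : IsTypeFC cs) {s : B} {I : Set B} (hs : s ∈ I)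
    (hIirr : IsIrreducible cs I) (hIsph : IsSpherical cs I)
    (hsup : ∀ x ∈ (I ∪ perp cs I)ᶜ, ∀ μ ν : Marking cs, μ.core = s → ν.core = s →
      insert x I ⊆ μ.support → insert x I ⊆ ν.support → MoveEquiv μ ν)
    {x y : ((I ∪ perp cs I)ᶜ : Set B)}
    (hxy : ((definingGraph cs).induce ((I ∪ perp cs I)ᶜ)).Reachable x y) {μ ν : Marking cs}
    (hμ : μ.core = s) (hν : ν.core = s) (hμx : μ.PointsTo I x) (hνy : ν.PointsTo I y) :
    MoveEquiv μ ν := by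
  have not_insert (μ : Marking cs) (hI : μ.support = I) : ∃ j ∈ I, M μ.marker j = 0 :=
    hI ▸ μ.exists_eq_zero hFC
  have hins (x : B) (hx : x ∈ (I ∪ perp cs I)ᶜ) : IsIrreducible cs (insert x I) :=
    hIirr.insert ⟨s, hs⟩ hIsph hx
  have same (x : ((I ∪ perp cs I)ᶜ : Set B)) {μ ν : Marking cs} (hμ : μ.core = s)
      (hν : ν.core = s) (hμx : μ.PointsTo I x) (hνx : ν.PointsTo I x) : MoveEquiv μ ν := by
    have mixed {μ ν : Marking cs} (hμx : μ.support = I ∧ μ.marker = x)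
        (hνx : insert x.1 I ⊆ ν.support) : False := by
      obtain ⟨j, hj, h0⟩ := not_insert μ hμx.1
      rw [hμx.2] at h0
      exact ne_zero_of_isSpherical ν.isSpherical (hνx (Or.inl rfl)) (hνx (Or.inr hj)) h0
    rcases hμx with h1 | h1 <;> rcases hνx with h2 | h2
    · rw [Marking.ext_of_support_marker (hμ.trans hν.symm) (h1.1.trans h2.1.symm)
        (h1.2.trans h2.2.symm)]
      exact Relation.EqvGen.refl _
    · exact (mixed h1 h2).elim
    · exact (mixed h2 h1).elim
    · exact hsup x x.2 μ ν hμ hν h1 h2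
  have mixed (x y : ((I ∪ perp cs I)ᶜ : Set B)) (hadj : (definingGraph cs).Adj x y)
      {μ ν : Marking cs} (hμ : μ.core = s) (hν : ν.core = s)
      (h1 : μ.support = I ∧ μ.marker = x) (h2 : insert y.1 I ⊆ ν.support) : MoveEquiv μ ν := by
    obtain ⟨j, hj, hnj⟩ := μ.marker_spec
    rw [h1.1] at hj
    -- Enlarging the support of `μ` by `y`, with the marker kept, is an M2 move because `y` is
    -- adjacent to that marker `x`.
    obtain ⟨ρ, hρ1, hρ2, hρ3⟩ := exists_marking (s := s) (J := insert y.1 I) (m := μ.marker)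
      (Set.mem_insert_of_mem _ hs) (hins y y.2) (ν.isSpherical.mono h2)
      ⟨j, Set.mem_insert_of_mem _ hj, hnj⟩
    have hmove : MoveTwo ρ μ := ⟨hρ1.trans hμ.symm, hρ3, y, by
      rw [hρ2, h1.1, Set.union_singleton], by rw [hρ3, h1.2]; exact hadj⟩
    exact hmove.moveEquiv.symm.trans (hsup y y.2 ρ ν hρ1 hν hρ2.ge h2)
  have step (x y : ((I ∪ perp cs I)ᶜ : Set B)) (hadj : (definingGraph cs).Adj x y)
      {μ ν : Marking cs} (hμ : μ.core = s) (hν : ν.core = s) (hμx : μ.PointsTo I x)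
      (hνy : ν.PointsTo I y) : MoveEquiv μ ν := by
    rcases hμx with h1 | h1 <;> rcases hνy with h2 | h2
    · exact MoveOne.moveEquiv ⟨hμ.trans hν.symm, h1.1.trans h2.1.symm, by rwa [h1.2, h2.2]⟩
    · exact mixed x y hadj hμ hν h1 h2
    · exact (mixed y x hadj.symm hν hμ h2 h1).symm
    -- Finiteness of the exponents comes from `μ` for `x` and `I`, from `ν` for `y` and `I`, and
    -- from adjacency for `x` and `y`. A marking with support containing all three can be compared
    -- with `μ` through `x` and with `ν` through `y`.
    · have hxyI : IsSpherical cs (insert x.1 (insert y.1 I)) := by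
        refine isSpherical_insert hFC (ν.isSpherical.mono h2) ?_
        rintro j (rfl | hj)
        · exact ((definingGraph_adj_iff hFC).1 hadj).2
        · exact ne_zero_of_isSpherical μ.isSpherical (h1 (Or.inl rfl)) (h1 (Or.inr hj))
      have hirr' : IsIrreducible cs (insert x.1 (insert y.1 I)) := by
        refine (hins y y.2).insert ⟨s, Or.inr hs⟩ (ν.isSpherical.mono h2) ?_
        rintro (h | h)
        · rcases h with h | h
          · exact hadj.1 h
          · exact x.2 (Or.inl h)
        · exact x.2 (Or.inr ⟨fun h' => x.2 (Or.inl h'), fun j hj => h.2 j (Or.inr hj)⟩)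
      obtain ⟨ρ, hρ, hsub⟩ := exists_marking_support_supset hirr hnonsph hFC
        (Or.inr (Or.inr hs)) hirr' hxyI
      have hx' : insert x.1 I ⊆ ρ.support :=
        (Set.insert_subset_insert (Set.subset_insert _ _)).trans hsub
      exact (hsup x x.2 μ ρ hμ hρ h1 hx').trans
        (hsup y y.2 ρ ν hρ hν ((Set.subset_insert _ _).trans hsub) h2)
  -- Intermediate vertices of the path need markings too: `x` is a marker for `I`, or else `I ∪ {x}`
  -- is spherical and lies in some support.
  have exist (x : ((I ∪ perp cs I)ᶜ : Set B)) : ∃ μ : Marking cs, μ.core = s ∧ μ.PointsTo I x := by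
    by_cases hx : ∃ j ∈ I, ¬ IsSpherical cs {x.1, j}
    · obtain ⟨μ, h1, h2, h3⟩ := exists_marking hs hIirr hIsph hx
      exact ⟨μ, h1, Or.inl ⟨h2, h3⟩⟩
    · push Not at hx
      obtain ⟨μ, h1, h2⟩ := exists_marking_support_supset hirr hnonsph hFC
        (Set.mem_insert_of_mem x.1 hs) (hins x x.2)
        (isSpherical_insert hFC hIsph fun j hj => (isSpherical_pair_iff hFC).1 (hx j hj))
      exact ⟨μ, h1, Or.inr h2⟩
  obtain ⟨p⟩ := hxy
  induction p generalizing μ with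
  | nil => exact same _ hμ hν hμx hνy
  | cons hadj p ih =>
    obtain ⟨ρ, hρ, hρz⟩ := exist _
    exact (step _ _ hadj hμ hρ hμx hρz).trans (ih hρ hρz hνy)

theorem moveEquiv_of_relSet (hirr : IsIrreducible cs Set.univ)
    (hnonsph : ¬ IsSpherical cs Set.univ) (hFC : IsTypeFC cs) {s : B}
    (I : {J : Set B // IsSpherical cs J}) (hs : s ∈ I.1) (hIirr : IsIrreducible cs I.1)
    (hmax : ∀ I' : Set B, I.1 ⊂ I' → IsIrreducible cs I' → IsSpherical cs I' →
      ¬ WeaklySeparates cs I')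
    {x y : ((I.1 ∪ perp cs I.1)ᶜ : Set B)}
    (hxy : ((definingGraph cs).induce ((I.1 ∪ perp cs I.1)ᶜ)).Reachable x y) {μ ν : Marking cs}
    (hμ : μ.core = s) (hν : ν.core = s) (hμx : x.1 ∈ μ.relSet I.1) (hνy : y.1 ∈ ν.relSet I.1) :
    MoveEquiv μ ν := by
  induction I using (wellFoundedGT_spherical hFC).wf.induction generalizing μ ν with
  | _ I ih =>
    refine moveEquiv_of_reachable hirr hnonsph hFC hs hIirr I.2 ?_ hxy hμ hν
      (Marking.pointsTo_of_mem_relSet hμx) (Marking.pointsTo_of_mem_relSet hνy)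
    intro z hz μ ν hμ hν hμz hνz
    have hsph := μ.isSpherical.mono hμz
    have hirr' := hIirr.insert ⟨s, hs⟩ I.2 hz
    have hlt : I.1 ⊂ insert z I.1 := Set.ssubset_insert fun h => hz (Or.inl h)
    have hne : (insert z I.1).Nonempty := ⟨z, Or.inl rfl⟩
    obtain ⟨a, ha⟩ := μ.relSet_nonempty hne hμz
    obtain ⟨b, hb⟩ := ν.relSet_nonempty hne hνz
    -- For `I ∪ {z}` the common-component condition is free, as its complement is connected.
    have hreach := reachable_of_not_weaklySeparates hirr' hsph (hmax _ hlt hirr' hsph)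
      ⟨a, μ.relSet_subset_compl hFC _ ha⟩ ⟨b, ν.relSet_subset_compl hFC _ hb⟩
    exact ih ⟨insert z I.1, hsph⟩ hlt (Or.inr hs) hirr' (fun I' h => hmax I' (hlt.trans h))
      hreach hμ hν ha hb

end Moves

end CoxDavis

theorem mainTheorem4 {B B' W : Type*} [Group W] {M : CoxeterMatrix B} {M' : CoxeterMatrix B'}
    (cs : CoxeterSystem M W) (cs' : CoxeterSystem M' W)
    (hirr : CoxDavis.IsIrreducible cs Set.univ)
    (hnonsph : ¬ CoxDavis.IsSpherical cs Set.univ)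
    (hFC : CoxDavis.IsTypeFC cs)
    (hangle : CoxDavis.IsAngleCompatible cs cs')
    (I : Set B) (hIirr : CoxDavis.IsIrreducible cs I) (hIsph : CoxDavis.IsSpherical cs I)
    (hmax : ∀ I' : Set B, I ⊂ I' → CoxDavis.IsIrreducible cs I' → CoxDavis.IsSpherical cs I' →
      ¬ CoxDavis.WeaklySeparates cs I')
    (s : B) (hs : s ∈ I) (μ₁ μ₂ : CoxDavis.Marking cs)
    (hcore₁ : μ₁.core = s) (hcore₂ : μ₂.core = s)
    (hsupp₁ : I ⊆ μ₁.support) (hsupp₂ : I ⊆ μ₂.support)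
    (C : Set B) (hC : CoxDavis.IsComponent cs I C)
    (hK₁ : μ₁.relSet I ⊆ C) (hK₂ : μ₂.relSet I ⊆ C) :
    CoxDavis.MoveEquiv μ₁ μ₂ ∧
      ∃ Φ : Set (CoxDavis.Point cs'),
        (∀ Ψ, CoxDavis.IsMarkingHalfSpace cs' μ₁ Ψ ↔ Ψ = Φ) ∧
        (∀ Ψ, CoxDavis.IsMarkingHalfSpace cs' μ₂ Ψ ↔ Ψ = Φ) := by
  have hmove : CoxDavis.MoveEquiv μ₁ μ₂ := by
    obtain ⟨c, rfl⟩ := hC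
    obtain ⟨k₁, hk₁⟩ := μ₁.relSet_nonempty ⟨s, hs⟩ hsupp₁
    obtain ⟨k₂, hk₂⟩ := μ₂.relSet_nonempty ⟨s, hs⟩ hsupp₂
    obtain ⟨x, hx, rfl⟩ := hK₁ hk₁
    obtain ⟨y, hy, rfl⟩ := hK₂ hk₂
    exact CoxDavis.moveEquiv_of_relSet hirr hnonsph hFC ⟨I, hIsph⟩ hs hIirr hmax
      (SimpleGraph.ConnectedComponent.exact (hx.trans hy.symm)) hcore₁ hcore₂ hk₁ hk₂
  refine ⟨hmove, ?_⟩
  obtain ⟨x, hx⟩ := μ₁.wall_nonempty hangle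
  have h := μ₁.isMarkingHalfSpace_iff hFC hangle hx
  exact ⟨_, h, fun Ψ => (hmove.isMarkingHalfSpace_iff hFC hangle Ψ).symm.trans (h Ψ)⟩
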